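/- **Setting.** Let $\Sigma$ be a finite ranked signature, and let $X\notin\Sigma$. A context is a tree over $\Sigma\cup\{X\}$ with exactly one occurrence of the hole $X$; $C[t]$ and $C[D]$ denote the substitution of a tree $t$ or a context $D$ for the hole. Constants have height $1$, $\mathrm{ht}(X)=0$, and a symbol with its children has height one more than the maximal height of the children. Tokens are $a,b,c,d,\bar a,\bar b,\bar c,\bar d,\langle,\rangle$. Each constant of $\Sigma$ carries a token or the empty word, and the projective yield $\mathrm{yd}(t)$ is the left-to-right concatenation of the words at the leaves of $t$; for a context, $\mathrm{yd}(C)$ is the word generated to the left of the hole followed by the word generated to its right. $|w|_z$ is the number of occurrences of $z$ in $w$. Let $G$ be a linear monadic context-free tree grammar over $\Sigma$: it has finitely many nonterminals, of rank $0$ or $1$, a start symbol of rank $0$, and finitely many rules $A\to r$ ($A$ of rank $0$, $r$ a tree over terminals and nonterminals) and $A(X)\to R$ ($A$ of rank $1$, $R$ a context over terminals and nonterminals). Let $\mathbf T=L(G)$ be the set of trees over $\Sigma$ that are derived from the start symbol by rewriting. Let $\mathsf{HR}_k$ be the HR algebra of finite directed edge-labelled multigraphs with at most $k$ named sources (constants,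 parallel composition, renaming and forgetting of sources), let $h$ be a tree homomorphism from trees over $\Sigma$ to terms over $\mathsf{HR}_k$, and let $$\mathcal{REL}=\mathcal{REL}((G,\mathrm{yd}),h,\mathsf{HR}_k)=\{\langle \mathrm{yd}(t),[\![h(t)]\!]\rangle : t\in\mathbf T\}$$ (graphs up to isomorphism). Let $\mathsf{CSD}_s=\bigcup_{m,n\ge 1}A^mB^nC^mD^n$, where $A=\{a\,\langle^i\bar a^i\rangle^i : i\ge 0\}$, and $B,C,D$ are defined likewise from $b,c,d$. Let $\mathsf{Sep}=\{a/c,\;c/a,\;b/d,\;d/b\}$. A tree $t$ is *$x,y,l$-separated* if $t=D_x[D_0[t_y]]$ for some contexts $D_x,D_0$ and some tree $t_y$ with $|\mathrm{yd}(D_x)|_y=0$, $|\mathrm{yd}(D_0)|_x\le l$ and $|\mathrm{yd}(t_y)|_x=0$. A number $p\in\mathbb N_0$ is a *pumping height* of $\mathbf T$ if every $t\in\mathbf T$ with $\mathrm{ht}(t)>p$ can be written $t=C_1[C_2[C_3[C_4[t_5]]]]$ with $\mathrm{ht}(C_2[C_3[C_4]])\le p$, $\mathrm{ht}(C_2)+\mathrm{ht}(C_4)>0$,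 and $C_1[v^i[t_5]]\in\mathbf T$ for all $i\ge 0$, where $v^0=C_3$ and $v^{i+1}=C_2[v^i[C_4]]$. **Statement.** Suppose that the set of strings occurring in $\mathcal{REL}$ is $\mathsf{CSD}_s$ (this holds in particular if $\mathcal{REL}$ equals the relation $\mathsf{CSD}$, which pairs the strings of $\mathsf{CSD}_s$ with graphs). Then $\mathbf T$ has a pumping height. Moreover, for every pumping height $p$ of $\mathbf T$ there is a maximal number $l_0$ of string tokens or of edges that a context of height at most $p$ generates under $\mathrm{yd}$ and $h$ (the larger of the two maxima), and with this $l_0$, every $t\in\mathbf T$ is $x,y,l_0$-separated for some $x/y\in\mathsf{Sep}$. -/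

import Mathlib

namespace CrossSerial

/-! Ranked trees and one-hole contexts -/

/-- A ranked signature: symbols, each with a rank. -/
structure Signature where
  Sym : Type
  rank : Sym → ℕ

/-- Trees over a ranked signature (a symbol of rank `0` applied to nothing is a constant). -/
inductive Tree (S : Signature) : Type
  | node (f : S.Sym) (ts : Fin (S.rank f) → Tree S) : Tree S

/-- Contexts: trees with exactly one occurrence of the hole `X`.  `node f i ts C` has the
context `C` as its child number `i` and the trees `ts j` as its other children. -/
inductive Ctx (S : Signature) : Type
  | hole : Ctx S
  | node (f : S.Sym) (i : Fin (S.rank f)) (ts : {j : Fin (S.rank f) // j ≠ i} → Tree S)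
      (C : Ctx S) : Ctx S

/-- Height of a tree; constants have height `1`. -/
def Tree.height {S : Signature} : Tree S → ℕ
  | .node _ ts => 1 + Finset.univ.sup fun j => (ts j).height

/-- Height of a context; the hole has height `0`. -/
def Ctx.height {S : Signature} : Ctx S → ℕ
  | .hole => 0
  | .node _ _ ts C => 1 + max (Finset.univ.sup fun j => (ts j).height) C.height

/-- `C.fill t` is the tree `C[t]`. -/
def Ctx.fill {S : Signature} : Ctx S → Tree S → Tree S
  | .hole, t => t
  | .node f i ts C, t => .node f fun j => if hj : j = i then C.fill t else ts ⟨j, hj⟩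

/-- `C.comp D` is the context `C[D]`. -/
def Ctx.comp {S : Signature} : Ctx S → Ctx S → Ctx S
  | .hole, D => D
  | .node f i ts C, D => .node f i ts (C.comp D)

/-! Projective yield.  The function `lex` gives the token carried by a constant (`none` stands
for the empty word); its values at symbols of positive rank are irrelevant. -/

/-- The left-to-right concatenation of the tokens at the leaves of a tree. -/
def Tree.yield {S : Signature} {W : Type} (lex : S.Sym → Option W) : Tree S → List W
  | .node f ts =>
      if S.rank f = 0 then (lex f).toList
      else (List.finRange (S.rank f)).flatMap fun j => (ts j).yield lex

/-- The string generated by a context to the left of its hole. -/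
def Ctx.left {S : Signature} {W : Type} (lex : S.Sym → Option W) : Ctx S → List W
  | .hole => []
  | .node f i ts C =>
      ((List.finRange (S.rank f)).flatMap fun j =>
        if hj : j < i then (ts ⟨j, ne_of_lt hj⟩).yield lex else []) ++ C.left lex

/-- The string generated by a context to the right of its hole. -/
def Ctx.right {S : Signature} {W : Type} (lex : S.Sym → Option W) : Ctx S → List W
  | .hole => []
  | .node f i ts C =>
      C.right lex ++ ((List.finRange (S.rank f)).flatMap fun j =>
        if hj : i < j then (ts ⟨j, ne_of_gt hj⟩).yield lex else [])

/-- The yield of a context. -/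
def Ctx.yield {S : Signature} {W : Type} (lex : S.Sym → Option W) (C : Ctx S) : List W :=
  C.left lex ++ C.right lex

/-! Linear monadic context-free tree grammars -/

/-- The signature of terminals and of nonterminals of rank `0` (in `N₀`) and `1` (in `N₁`). -/
def Signature.extend (S : Signature) (N₀ N₁ : Type) : Signature where
  Sym := (N₀ ⊕ N₁) ⊕ S.Sym
  rank := Sum.elim (Sum.elim (fun _ => 0) (fun _ => 1)) S.rank

/-- A linear monadic context-free tree grammar with terminal signature `S`: nonterminals of rank
zero rewrite to trees, nonterminals of rank one rewrite to contexts. -/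
structure LMCFTG (S : Signature) where
  N₀ : Type
  N₁ : Type
  finite_N₀ : Finite N₀
  finite_N₁ : Finite N₁
  start : N₀
  rules₀ : Set (N₀ × Tree (S.extend N₀ N₁))
  rules₁ : Set (N₁ × Ctx (S.extend N₀ N₁))
  finite_rules₀ : rules₀.Finite
  finite_rules₁ : rules₁.Finite

/-- A terminal tree, seen as a sentential form. -/
def Tree.lift {S : Signature} (N₀ N₁ : Type) : Tree S → Tree (S.extend N₀ N₁)
  | .node f ts => .node (S := S.extend N₀ N₁) (Sum.inr f) fun j => (ts j).lift N₀ N₁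

/-- The sentential form consisting of a nonterminal of rank zero. -/
def Tree.nt₀ (S : Signature) {N₀ : Type} (N₁ : Type) (A : N₀) : Tree (S.extend N₀ N₁) :=
  .node (S := S.extend N₀ N₁) (Sum.inl (Sum.inl A)) Fin.elim0

/-- The sentential form `A(s)` for a nonterminal `A` of rank one. -/
def Tree.nt₁ {S : Signature} {N₀ N₁ : Type} (A : N₁) (s : Tree (S.extend N₀ N₁)) :
    Tree (S.extend N₀ N₁) :=
  .node (S := S.extend N₀ N₁) (Sum.inl (Sum.inr A)) fun _ => s

/-- One rewriting step, at an arbitrary position. -/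
inductive LMCFTG.Step {S : Signature} (G : LMCFTG S) :
    Tree (S.extend G.N₀ G.N₁) → Tree (S.extend G.N₀ G.N₁) → Prop
  | expand₀ (K : Ctx (S.extend G.N₀ G.N₁)) (A : G.N₀) (r : Tree (S.extend G.N₀ G.N₁))
      (hr : (A, r) ∈ G.rules₀) : G.Step (K.fill (Tree.nt₀ S G.N₁ A)) (K.fill r)
  | expand₁ (K : Ctx (S.extend G.N₀ G.N₁)) (A : G.N₁) (R : Ctx (S.extend G.N₀ G.N₁))
      (hR : (A, R) ∈ G.rules₁) (s : Tree (S.extend G.N₀ G.N₁)) :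
      G.Step (K.fill (Tree.nt₁ A s)) (K.fill (R.fill s))

/-- The tree language generated by the grammar. -/
def LMCFTG.language {S : Signature} (G : LMCFTG S) : Set (Tree S) :=
  {t | Relation.ReflTransGen G.Step (Tree.nt₀ S G.N₁ G.start) (t.lift G.N₀ G.N₁)}

/-! Pumping -/

/-- The iterated contexts `v⁰ = C₃`, `vⁱ⁺¹ = C₂[vⁱ[C₄]]`. -/
def pump {S : Signature} (C₂ C₃ C₄ : Ctx S) : ℕ → Ctx S
  | 0 => C₃
  | i + 1 => C₂.comp ((pump C₂ C₃ C₄ i).comp C₄)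

/-- `(C₁, C₂, C₃, C₄, t₅)` is a pumping decomposition of `t` with respect to the height `p`. -/
def IsPumpingDecomposition {S : Signature} (T : Set (Tree S)) (p : ℕ) (t : Tree S)
    (C₁ C₂ C₃ C₄ : Ctx S) (t₅ : Tree S) : Prop :=
  t = C₁.fill (C₂.fill (C₃.fill (C₄.fill t₅))) ∧
  (C₂.comp (C₃.comp C₄)).height ≤ p ∧
  0 < C₂.height + C₄.height ∧
  ∀ i : ℕ, C₁.fill ((pump C₂ C₃ C₄ i).fill t₅) ∈ T

/-- `p` is a pumping height of `T`: all trees of `T` higher than `p` can be pumped. -/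
def IsPumpingHeight {S : Signature} (T : Set (Tree S)) (p : ℕ) : Prop :=
  ∀ t ∈ T, p < t.height →
    ∃ (C₁ C₂ C₃ C₄ : Ctx S) (t₅ : Tree S), IsPumpingDecomposition T p t C₁ C₂ C₃ C₄ t₅

/-! The HR algebra with `k` sources -/

/-- Finite directed multigraphs with edge labels in `L` and at most `k` sources: `edges` lists the
edges as (origin, label, target), and `src a` is the node with source name `a`, if any. -/
structure SGraph (k : ℕ) (L : Type) where
  V : Type
  finite_V : Finite V
  edges : Multiset (V × L × V)
  src : Fin k → Option V

/-- Isomorphism of s-graphs. -/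
def SGraph.Iso {k : ℕ} {L : Type} (g g' : SGraph k L) : Prop :=
  ∃ e : g.V ≃ g'.V, g.edges.map (fun x => (e x.1, x.2.1, e x.2.2)) = g'.edges ∧
    ∀ a, (g.src a).map e = g'.src a

/-- Two nodes of the disjoint union are to be fused when they carry the same source name. -/
def SGraph.Glue {k : ℕ} {L : Type} (g g' : SGraph k L) : g.V ⊕ g'.V → g.V ⊕ g'.V → Prop :=
  fun u v => ∃ (a : Fin k) (x : g.V) (y : g'.V),
    g.src a = some x ∧ g'.src a = some y ∧ u = Sum.inl x ∧ v = Sum.inr y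

/-- Parallel composition: disjoint union, followed by the fusion of equally named sources. -/
def SGraph.merge {k : ℕ} {L : Type} (g g' : SGraph k L) : SGraph k L where
  V := Quot (g.Glue g')
  finite_V := by
    have := g.finite_V
    have := g'.finite_V
    exact Finite.of_surjective (Quot.mk (g.Glue g')) Quot.mk_surjective
  edges :=
    g.edges.map (fun x => (Quot.mk _ (Sum.inl x.1), x.2.1, Quot.mk _ (Sum.inl x.2.2))) +
    g'.edges.map (fun x => (Quot.mk _ (Sum.inr x.1), x.2.1, Quot.mk _ (Sum.inr x.2.2)))
  src a :=
    ((g.src a).map fun x => Quot.mk _ (Sum.inl x)).or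
      ((g'.src a).map fun y => Quot.mk _ (Sum.inr y))

/-- Renaming of the source names: the `a`-source becomes the `π a`-source. -/
def SGraph.rename {k : ℕ} {L : Type} (π : Equiv.Perm (Fin k)) (g : SGraph k L) : SGraph k L :=
  { g with src := fun a => g.src (π.symm a) }

/-- The node with source name `a` ceases to be the `a`-source. -/
def SGraph.forget {k : ℕ} {L : Type} (a : Fin k) (g : SGraph k L) : SGraph k L :=
  { g with src := fun b => if b = a then none else g.src b }

/-- Terms over the HR algebra with `k` sources, with variables in `X`. -/
inductive HRTerm (k : ℕ) (L : Type) (X : Type) : Type 1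
  | var (x : X) : HRTerm k L X
  | const (g : SGraph k L) : HRTerm k L X
  | merge (s t : HRTerm k L X) : HRTerm k L X
  | rename (π : Equiv.Perm (Fin k)) (t : HRTerm k L X) : HRTerm k L X
  | forget (a : Fin k) (t : HRTerm k L X) : HRTerm k L X

/-- Substitution of terms for variables. -/
def HRTerm.subst {k : ℕ} {L X Y : Type} (σ : X → HRTerm k L Y) : HRTerm k L X → HRTerm k L Y
  | .var x => σ x
  | .const g => .const g
  | .merge s t => .merge (s.subst σ) (t.subst σ)
  | .rename π t => .rename π (t.subst σ)
  | .forget a t => .forget a (t.subst σ)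

/-- The value of a closed term in the HR algebra. -/
def HRTerm.eval {k : ℕ} {L : Type} : HRTerm k L Empty → SGraph k L
  | .var x => x.elim
  | .const g => g
  | .merge s t => s.eval.merge t.eval
  | .rename π t => t.eval.rename π
  | .forget a t => t.eval.forget a

/-- The number of edges generated by a term (variables generate none). -/
def HRTerm.edgeCount {k : ℕ} {L X : Type} : HRTerm k L X → ℕ
  | .var _ => 0
  | .const g => g.edges.card
  | .merge s t => s.edgeCount + t.edgeCount
  | .rename _ t => t.edgeCount
  | .forget _ t => t.edgeCount

/-- A tree homomorphism into the terms over the HR algebra with `k` sources: a term with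
variables `x₁, …, xₙ` for every symbol of rank `n`. -/
def HRHom (S : Signature) (k : ℕ) (L : Type) : Type 1 :=
  (f : S.Sym) → HRTerm k L (Fin (S.rank f))

/-- The image of a tree under a tree homomorphism. -/
def HRHom.tree {S : Signature} {k : ℕ} {L : Type} (h : HRHom S k L) :
    Tree S → HRTerm k L Empty
  | .node f ts => (h f).subst fun j => h.tree (ts j)

/-- The image of a context under a tree homomorphism, with one variable for the hole. -/
def HRHom.ctx {S : Signature} {k : ℕ} {L : Type} (h : HRHom S k L) :
    Ctx S → HRTerm k L Unit
  | .hole => .var ()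
  | .node f i ts C => (h f).subst fun j =>
      if hj : j = i then h.ctx C else (h.tree (ts ⟨j, hj⟩)).subst fun x => x.elim

/-- The string-graph relation described by a grammar, the projective yield and a homomorphism;
graphs are taken up to isomorphism. -/
def REL {S : Signature} {W : Type} {k : ℕ} {L : Type} (G : LMCFTG S) (lex : S.Sym → Option W)
    (h : HRHom S k L) : Set (List W × SGraph k L) :=
  {q | ∃ t ∈ G.language, q.1 = t.yield lex ∧ (h.tree t).eval.Iso q.2}

/-- The numbers of string tokens and the numbers of edges that are generated by contexts of height
at most `p`. -/
def generatedSizes {S : Signature} {W : Type} {k : ℕ} {L : Type} (lex : S.Sym → Option W)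
    (h : HRHom S k L) (p : ℕ) : Set ℕ :=
  {n | ∃ C : Ctx S, C.height ≤ p ∧ (n = (C.yield lex).length ∨ n = (h.ctx C).edgeCount)}

/-! The string language of cross-serial dependencies -/

/-- The four core letters. -/
inductive Letter
  | a | b | c | d
  deriving DecidableEq

/-- Tokens: the core letters, their barred copies, and two brackets. -/
inductive Token
  | core (x : Letter)
  | bar (x : Letter)
  | lbr
  | rbr
  deriving DecidableEq

/-- The word consisting of `x`, then `i` opening brackets, `i` barred copies of `x`, and `i`
closing brackets. -/
def block (x : Letter) (i : ℕ) : List Token :=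
  Token.core x :: (List.replicate i Token.lbr ++ List.replicate i (Token.bar x) ++
    List.replicate i Token.rbr)

/-- The strings of `AᵐBⁿCᵐDⁿ` with `m, n ≥ 1`, where `A`, `B`, `C`, `D` are the sets of blocks of the
letters `a`, `b`, `c`, `d`; the bracket depths of the blocks are independent of each other. -/
def CSDStrings : Set (List Token) :=
  {w | ∃ α β γ δ : List ℕ, α ≠ [] ∧ β ≠ [] ∧ α.length = γ.length ∧ β.length = δ.length ∧
    w = α.flatMap (block .a) ++ β.flatMap (block .b) ++ γ.flatMap (block .c) ++
      δ.flatMap (block .d)}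

/-- The pairs `x/y` of letters that depend on each other, in both orders. -/
def SepPairs : Set (Letter × Letter) :=
  {(.a, .c), (.c, .a), (.b, .d), (.d, .b)}

/-- `t` is `x,y,l`-separated: `t = Dₓ[D₀[t_y]]`, where `Dₓ` generates no `y`, the tree `t_y` generates
no `x`, and `D₀` generates at most `l` occurrences of `x`. -/
def IsSeparated {S : Signature} (lex : S.Sym → Option Token) (x y : Letter) (l : ℕ)
    (t : Tree S) : Prop :=
  ∃ (Dx D₀ : Ctx S) (ty : Tree S), t = Dx.fill (D₀.fill ty) ∧
    (Dx.yield lex).count (.core y) = 0 ∧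
    (D₀.yield lex).count (.core x) ≤ l ∧
    (ty.yield lex).count (.core x) = 0

end CrossSerial

open CrossSerial

namespace CrossSerial

variable {S : Signature}

-- Separation follows by playing pumping against the alphabetical order of the core letters; the
-- bracket depths play no part. Suppose that `t` is neither `a,c,l`- nor `d,b,l`-separated. Choose a
-- subtree that contains every `b` while none of its children does. It has more than `l` letters
-- `d`, since `t` is not `d,b`-separated. A factor with `b` and `d` leaves no `c` outside, so every
-- `c` is in it too, and it has more than `l` letters `a`, since `t` is not `a,c`-separated. By the
-- choice of the subtree, no child has both `a` and `c`, both `b` and `d`, or both `a` and `d`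
-- (`hasSpread_of_not_isSeparated`). Thus two of the four pairs suffice.
--
-- This configuration survives pumping down (`HasSpread.shrink`). The pumped context has at most `l`
-- tokens, and since the yields before and after are both cross-serial, it loses as many `a` as `c`
-- and as many `b` as `d`. Inside a child of the spread node, or beside the path to that node, it
-- lacks a letter of each pair and hence loses no core letter at all. Otherwise its hole is at or
-- above the node, which stays intact. Pumping down decreases the size, so a tree of height at most
-- `p` is reached; there, the context that leads to a leaf with token `b` generates more than `l`
-- letters `a`, which contradicts the choice of `l` (`IsPumpingHeight.not_hasSpread`).
--
-- A pumping height exists because derivations pass through finitely many states, the parts of the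
-- right-hand sides. A state that recurs, for trees or along the spine of a context, can be pumped,
-- and where nothing can be pumped the height is bounded (`LMCFTG.pump_or_height_le`).

theorem Ctx.fill_comp (C D : Ctx S) (t : Tree S) : (C.comp D).fill t = C.fill (D.fill t) := by
  induction C with
  | hole => rfl
  | node f i ts C ih => simp only [Ctx.comp, Ctx.fill, ih]

theorem Ctx.comp_hole (C : Ctx S) : C.comp .hole = C := by
  induction C with
  | hole => rfl
  | node f i ts C ih => simp only [Ctx.comp, ih]

theorem Ctx.comp_assoc (C D E : Ctx S) : (C.comp D).comp E = C.comp (D.comp E) := by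
  induction C with
  | hole => rfl
  | node f i ts C ih => simp only [Ctx.comp, ih]

-- Heights under filling and composition

theorem Ctx.height_pos {C : Ctx S} (hC : C ≠ .hole) : 0 < C.height := by
  cases C with
  | hole => exact absurd rfl hC
  | node f i ts C => simp only [Ctx.height]; omega

theorem Tree.height_child_lt (f : S.Sym) (ts : Fin (S.rank f) → Tree S) (j : Fin (S.rank f)) :
    (ts j).height < (Tree.node f ts).height := by
  simp only [Tree.height]
  have := Finset.le_sup (f := fun j => (ts j).height) (Finset.mem_univ j)
  omega

theorem Tree.height_node_le {f : S.Sym} {ts : Fin (S.rank f) → Tree S} {b : ℕ}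
    (h : ∀ j, (ts j).height ≤ b) : (Tree.node f ts).height ≤ 1 + b := by
  simp only [Tree.height]
  have : (Finset.univ.sup fun j => (ts j).height) ≤ b := Finset.sup_le fun j _ => h j
  omega

theorem Ctx.height_node_le {f : S.Sym} {i : Fin (S.rank f)}
    {ts : {j : Fin (S.rank f) // j ≠ i} → Tree S} {C : Ctx S} {b : ℕ}
    (h : ∀ j, (ts j).height ≤ b) (hC : C.height ≤ b) : (Ctx.node f i ts C).height ≤ 1 + b := by
  simp only [Ctx.height]
  have : (Finset.univ.sup fun j => (ts j).height) ≤ b := Finset.sup_le fun j _ => h j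
  omega

theorem Ctx.height_side_lt (f : S.Sym) (i : Fin (S.rank f))
    (ts : {j : Fin (S.rank f) // j ≠ i} → Tree S) (C : Ctx S) (j : {j : Fin (S.rank f) // j ≠ i}) :
    (ts j).height < (Ctx.node f i ts C).height := by
  simp only [Ctx.height]
  have := Finset.le_sup (f := fun j => (ts j).height) (Finset.mem_univ j)
  omega

theorem Ctx.height_spine_lt (f : S.Sym) (i : Fin (S.rank f))
    (ts : {j : Fin (S.rank f) // j ≠ i} → Tree S) (C : Ctx S) :
    C.height < (Ctx.node f i ts C).height := by
  simp only [Ctx.height]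
  omega

theorem Ctx.height_le_fill (C : Ctx S) (t : Tree S) : C.height ≤ (C.fill t).height := by
  induction C with
  | hole => simp [Ctx.height]
  | node f i ts C ih =>
    have key : ∀ j, (if hj : j = i then C.fill t else ts ⟨j, hj⟩ : Tree S).height <
        ((Ctx.node f i ts C).fill t).height :=
      Tree.height_child_lt f fun j => if hj : j = i then C.fill t else ts ⟨j, hj⟩
    have hpos := key i
    simp only [dite_true] at hpos
    have : (Ctx.node f i ts C).height ≤ 1 + (((Ctx.node f i ts C).fill t).height - 1) := by
      refine Ctx.height_node_le (fun j => ?_) (by omega)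
      have := key j.1
      rw [dif_neg j.2] at this
      change (ts j).height < _ at this
      omega
    omega

theorem Ctx.height_fill_le (C : Ctx S) (t : Tree S) : (C.fill t).height ≤ C.height + t.height := by
  induction C with
  | hole => simp [Ctx.height, Ctx.fill]
  | node f i ts C ih =>
    have h1 := Ctx.height_spine_lt f i ts C
    have : ((Ctx.node f i ts C).fill t).height
        ≤ 1 + ((Ctx.node f i ts C).height - 1 + t.height) := by
      refine Tree.height_node_le fun j => ?_
      split_ifs with hj
      · omega
      · have := Ctx.height_side_lt f i ts C ⟨j, hj⟩
        omega
    omega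

theorem Ctx.height_comp_le (C D : Ctx S) : (C.comp D).height ≤ C.height + D.height := by
  induction C with
  | hole => simp [Ctx.height, Ctx.comp]
  | node f i ts C ih =>
    have h1 := Ctx.height_spine_lt f i ts C
    have : ((Ctx.node f i ts C).comp D).height
        ≤ 1 + ((Ctx.node f i ts C).height - 1 + D.height) := by
      refine Ctx.height_node_le (fun j => ?_) (by omega)
      have := Ctx.height_side_lt f i ts C j
      omega
    omega

/-- The one-level context around child `i` of `node f ts`. -/
def Ctx.around (f : S.Sym) (ts : Fin (S.rank f) → Tree S) (i : Fin (S.rank f)) : Ctx S :=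
  .node f i (fun j => ts j.1) .hole

theorem Ctx.around_fill (f : S.Sym) (ts : Fin (S.rank f) → Tree S) (i : Fin (S.rank f))
    (t : Tree S) : (Ctx.around f ts i).fill t = .node f (Function.update ts i t) := by
  simp only [Ctx.around, Ctx.fill]
  congr 1
  funext j
  rw [Function.update_apply]
  split_ifs <;> rfl

theorem Ctx.around_fill_self (f : S.Sym) (ts : Fin (S.rank f) → Tree S) (i : Fin (S.rank f)) :
    (Ctx.around f ts i).fill (ts i) = .node f ts := by
  rw [Ctx.around_fill, Function.update_eq_self]

-- Size, the measure that decreases when a tree is pumped down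

/-- The number of symbols of a tree. -/
def Tree.size : Tree S → ℕ
  | .node _ ts => 1 + ∑ j, (ts j).size

theorem Tree.size_child_lt (f : S.Sym) (ts : Fin (S.rank f) → Tree S) (i : Fin (S.rank f)) :
    (ts i).size < (Tree.node f ts).size := by
  simp only [Tree.size]
  have := Finset.single_le_sum (f := fun j => (ts j).size) (fun _ _ => Nat.zero_le _)
    (Finset.mem_univ i)
  omega

theorem Ctx.size_le_fill (C : Ctx S) (t : Tree S) : t.size ≤ (C.fill t).size := by
  induction C with
  | hole => exact le_rfl
  | node f i ts C ih =>
    have := Tree.size_child_lt f (fun j => if hj : j = i then C.fill t else ts ⟨j, hj⟩) i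
    simp only [dite_true] at this
    exact ih.trans this.le

theorem Ctx.size_lt_fill {C : Ctx S} (hC : C ≠ .hole) (t : Tree S) : t.size < (C.fill t).size := by
  cases C with
  | hole => exact absurd rfl hC
  | node f i ts C =>
    have := Tree.size_child_lt f (fun j => if hj : j = i then C.fill t else ts ⟨j, hj⟩) i
    simp only [dite_true] at this
    exact (C.size_le_fill t).trans_lt this

theorem Ctx.size_fill_lt_fill (C : Ctx S) {s t : Tree S} (h : s.size < t.size) :
    (C.fill s).size < (C.fill t).size := by
  induction C with
  | hole => exact h
  | node f i ts C ih =>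
    simp only [Ctx.fill, Tree.size]
    refine Nat.add_lt_add_left (Finset.sum_lt_sum (fun j _ => ?_) ⟨i, Finset.mem_univ i, ?_⟩) 1
    · split_ifs
      · exact ih.le
      · exact le_rfl
    · simpa using ih

theorem size_pump_zero_lt {C₂ C₃ C₄ : Ctx S} (C₁ : Ctx S) (t : Tree S)
    (h : 0 < C₂.height + C₄.height) :
    (C₁.fill (C₃.fill t)).size < (C₁.fill (C₂.fill (C₃.fill (C₄.fill t)))).size := by
  apply Ctx.size_fill_lt_fill
  by_cases h₂ : C₂ = .hole
  · have h₄ : C₄ ≠ .hole := by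
      rintro rfl
      subst h₂
      simp [Ctx.height] at h
    exact (C₃.size_fill_lt_fill (Ctx.size_lt_fill h₄ t)).trans_le (C₂.size_le_fill _)
  · refine lt_of_le_of_lt ?_ (Ctx.size_lt_fill h₂ _)
    by_cases h₄ : C₄ = .hole
    · subst h₄
      exact le_rfl
    · exact (C₃.size_fill_lt_fill (Ctx.size_lt_fill h₄ t)).le

/-! Finiteness of the sets of trees and contexts of bounded height -/

theorem finite_trees_height_le (hS : Finite S.Sym) (p : ℕ) : {t : Tree S | t.height ≤ p}.Finite := by
  induction p with
  | zero =>
    convert Set.finite_empty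
    ext t
    cases t
    simp [Tree.height]
  | succ p ih =>
    have : Finite {t : Tree S | t.height ≤ p} := ih
    refine (Set.finite_range fun x : (Σ f : S.Sym, Fin (S.rank f) → {t : Tree S | t.height ≤ p}) =>
      Tree.node x.1 fun j => (x.2 j).1).subset ?_
    rintro ⟨f, ts⟩ ht
    refine ⟨⟨f, fun j => ⟨ts j, ?_⟩⟩, rfl⟩
    have h₁ := Tree.height_child_lt f ts j
    have h₂ : (Tree.node f ts).height ≤ p + 1 := ht
    change (ts j).height ≤ p
    omega

theorem finite_contexts_height_le (hS : Finite S.Sym) (p : ℕ) :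
    {C : Ctx S | C.height ≤ p}.Finite := by
  induction p with
  | zero =>
    refine (Set.finite_singleton Ctx.hole).subset ?_
    rintro C hC
    by_contra hne
    have h₁ := Ctx.height_pos (C := C) hne
    have h₂ : C.height ≤ 0 := hC
    omega
  | succ p ih =>
    have : Finite {C : Ctx S | C.height ≤ p} := ih
    have : Finite {t : Tree S | t.height ≤ p} := finite_trees_height_le hS p
    refine ((Set.finite_singleton Ctx.hole).union (Set.finite_range
      fun x : (Σ f : S.Sym, Σ i : Fin (S.rank f),
        ({j : Fin (S.rank f) // j ≠ i} → {t : Tree S | t.height ≤ p}) × {C : Ctx S | C.height ≤ p}) =>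
      Ctx.node x.1 x.2.1 (fun j => (x.2.2.1 j).1) x.2.2.2.1)).subset ?_
    rintro (_ | ⟨f, i, ts, C⟩) hC
    · exact Or.inl rfl
    · have h₂ : (Ctx.node f i ts C).height ≤ p + 1 := hC
      refine Or.inr ⟨⟨f, i, fun j => ⟨ts j, ?_⟩, ⟨C, ?_⟩⟩, rfl⟩
      · have h₁ := Ctx.height_side_lt f i ts C j
        change (ts j).height ≤ p
        omega
      · have h₁ := Ctx.height_spine_lt f i ts C
        change C.height ≤ p
        omega

/-- Over a finite signature there are only finitely many contexts of bounded height, and the hole is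
always one of them. -/
theorem exists_isGreatest_generatedSizes {W L : Type} {k : ℕ} (hS : Finite S.Sym)
    (lex : S.Sym → Option W) (h : HRHom S k L) (p : ℕ) :
    ∃ l, IsGreatest (generatedSizes lex h p) l := by
  have hfin : (generatedSizes lex h p).Finite := by
    refine (((finite_contexts_height_le hS p).image fun C => (C.yield lex).length).union
      ((finite_contexts_height_le hS p).image fun C => (h.ctx C).edgeCount)).subset ?_
    rintro n ⟨C, hC, rfl | rfl⟩
    · exact Or.inl ⟨C, hC, rfl⟩
    · exact Or.inr ⟨C, hC, rfl⟩
  have hne : (generatedSizes lex h p).Nonempty :=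
    ⟨_, .hole, by simp [Ctx.height], Or.inl rfl⟩
  exact ⟨_, Nat.sSup_mem hne hfin.bddAbove, fun n hn => le_csSup hfin.bddAbove hn⟩

/-! Yields -/

section Yield

variable {W : Type} (lex : S.Sym → Option W)

theorem flatMap_finRange_split {α : Type} {n : ℕ} (g : Fin n → List α) (i : Fin n) :
    (List.finRange n).flatMap g =
      ((List.finRange n).flatMap fun j => if j < i then g j else []) ++ g i ++
        ((List.finRange n).flatMap fun j => if i < j then g j else []) := by
  induction n with
  | zero => exact i.elim0
  | succ n ih =>
    simp only [List.finRange_succ, List.flatMap_cons, List.flatMap_map]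
    refine Fin.cases ?_ (fun i => ?_) i
    · simp
    · rw [ih (fun j => g j.succ) i]
      simp

theorem sublist_flatMap_finRange {α : Type} {n : ℕ} (g : Fin n → List α) (i : Fin n) :
    (g i).Sublist ((List.finRange n).flatMap g) := by
  rw [flatMap_finRange_split g i]
  exact (List.sublist_append_right _ _).trans (List.sublist_append_left _ _)

theorem Ctx.yield_fill (C : Ctx S) (t : Tree S) :
    (C.fill t).yield lex = C.left lex ++ t.yield lex ++ C.right lex := by
  induction C with
  | hole => simp [Ctx.fill, Ctx.left, Ctx.right]
  | node f i ts C ih =>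
    have hf : S.rank f ≠ 0 := fun h => (h ▸ i : Fin 0).elim0
    simp only [Ctx.fill, Tree.yield, if_neg hf, Ctx.left, Ctx.right]
    rw [flatMap_finRange_split _ i]
    simp only [dite_true, ih, List.append_assoc]
    congr 1
    · congr 1
      funext j
      by_cases hj : j < i
      · simp [hj, hj.ne]
      · simp [hj]
    · congr 4
      funext j
      by_cases hj : i < j
      · simp [hj, hj.ne']
      · simp [hj]

theorem Ctx.left_comp (C D : Ctx S) : (C.comp D).left lex = C.left lex ++ D.left lex := by
  induction C with
  | hole => simp [Ctx.comp, Ctx.left]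
  | node f i ts C ih => simp [Ctx.comp, Ctx.left, ih]

theorem Ctx.right_comp (C D : Ctx S) : (C.comp D).right lex = D.right lex ++ C.right lex := by
  induction C with
  | hole => simp [Ctx.comp, Ctx.right]
  | node f i ts C ih => simp [Ctx.comp, Ctx.right, ih]

variable [DecidableEq W]

theorem Ctx.count_fill (x : W) (C : Ctx S) (t : Tree S) :
    ((C.fill t).yield lex).count x = (C.yield lex).count x + (t.yield lex).count x := by
  simp only [Ctx.yield_fill, Ctx.yield, List.count_append]
  omega

theorem Ctx.count_comp (x : W) (C D : Ctx S) :
    ((C.comp D).yield lex).count x = (C.yield lex).count x + (D.yield lex).count x := by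
  simp only [Ctx.left_comp, Ctx.right_comp, Ctx.yield, List.count_append]
  omega

theorem Ctx.count_side_le (x : W) (f : S.Sym) (i : Fin (S.rank f))
    (ts : {j : Fin (S.rank f) // j ≠ i} → Tree S) (C : Ctx S) (j : {j : Fin (S.rank f) // j ≠ i}) :
    ((ts j).yield lex).count x ≤ ((Ctx.node f i ts C).yield lex).count x := by
  simp only [Ctx.yield, Ctx.left, Ctx.right, List.count_append]
  obtain ⟨j, hj⟩ := j
  rcases lt_or_gt_of_ne hj with h | h
  · have := (sublist_flatMap_finRange (fun j => if hj : j < i then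
      (ts ⟨j, ne_of_lt hj⟩).yield lex else []) j).count_le x
    rw [dif_pos h] at this
    omega
  · have := (sublist_flatMap_finRange (fun j => if hj : i < j then
      (ts ⟨j, ne_of_gt hj⟩).yield lex else []) j).count_le x
    rw [dif_pos h] at this
    omega

theorem exists_child_count_pos {x : W} {f : S.Sym} {ts : Fin (S.rank f) → Tree S}
    (hf : S.rank f ≠ 0) (h : 0 < ((Tree.node f ts).yield lex).count x) :
    ∃ j, 0 < ((ts j).yield lex).count x := by
  simp only [Tree.yield, if_neg hf, List.count_pos_iff, List.mem_flatMap] at h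
  obtain ⟨j, -, hj⟩ := h
  exact ⟨j, List.count_pos_iff.2 hj⟩

/-- The subtree `u` is a leaf that carries `y`; a leaf carries at most one token, hence no `x`. -/
theorem exists_leaf_of_count_pos {x y : W} (hxy : x ≠ y) (s : Tree S)
    (h : 0 < (s.yield lex).count y) :
    ∃ (D : Ctx S) (u : Tree S), s = D.fill u ∧ (u.yield lex).count x = 0 := by
  induction s with
  | node f ts ih =>
    by_cases hf : S.rank f = 0
    · refine ⟨.hole, _, rfl, ?_⟩
      simp only [Tree.yield, if_pos hf] at h ⊢
      rw [List.count_pos_iff, Option.mem_toList] at h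
      rw [List.count_eq_zero, Option.mem_toList]
      intro h'
      exact hxy (Option.some.inj (h'.symm.trans h))
    · obtain ⟨j, hj⟩ := exists_child_count_pos lex hf h
      obtain ⟨D, u, hD, hu⟩ := ih j hj
      exact ⟨(Ctx.around f ts j).comp D, u, by rw [Ctx.fill_comp, ← hD, Ctx.around_fill_self], hu⟩

end Yield

/-! Core letters in the strings of cross-serial dependencies -/

/-- The position of a core letter in the alphabet. -/
def Letter.index : Letter → ℕ
  | .a => 0
  | .b => 1
  | .c => 2
  | .d => 3

/-- The core letters of a string occur in alphabetical order. -/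
def CoreSorted (w : List Token) : Prop :=
  w.Pairwise fun u v => ∀ x y, u = .core x → v = .core y → x.index ≤ y.index

theorem eq_of_core_mem_blocks {x y : Letter} {α : List ℕ}
    (h : Token.core y ∈ α.flatMap (block x)) : y = x := by
  simp only [List.mem_flatMap, block, List.mem_cons, List.mem_append, List.mem_replicate] at h
  obtain ⟨i, -, h⟩ := h
  simpa using h

theorem count_core_blocks (x y : Letter) (α : List ℕ) :
    (α.flatMap (block x)).count (.core y) = if x = y then α.length else 0 := by
  induction α with
  | nil => simp
  | cons i α ih =>
    simp only [List.flatMap_cons, List.count_append, ih, block, List.count_cons,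
      List.count_replicate]
    split_ifs <;> simp_all
    omega

theorem coreSorted_blocks (x : Letter) (α : List ℕ) : CoreSorted (α.flatMap (block x)) := by
  refine List.pairwise_of_forall_mem_list ?_
  rintro u hu v hv y z rfl rfl
  rw [eq_of_core_mem_blocks hu, eq_of_core_mem_blocks hv]

theorem coreSorted_append_blocks {w : List Token} {x : Letter} (α : List ℕ) (hw : CoreSorted w)
    (h : ∀ y, Token.core y ∈ w → y.index ≤ x.index) :
    CoreSorted (w ++ α.flatMap (block x)) := by
  refine List.pairwise_append.2 ⟨hw, coreSorted_blocks x α, ?_⟩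
  rintro u hu v hv y z rfl rfl
  rw [eq_of_core_mem_blocks hv]
  exact h y hu

theorem coreSorted_of_mem_CSDStrings {w : List Token} (hw : w ∈ CSDStrings) : CoreSorted w := by
  obtain ⟨α, β, γ, δ, -, -, -, -, rfl⟩ := hw
  have h₁ := coreSorted_append_blocks (x := .b) β (coreSorted_blocks .a α) fun y hy => by
    simp [eq_of_core_mem_blocks hy, Letter.index]
  have h₂ := coreSorted_append_blocks (x := .c) γ h₁ fun y hy => by
    rcases List.mem_append.1 hy with hy | hy <;> simp [eq_of_core_mem_blocks hy, Letter.index]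
  refine coreSorted_append_blocks (x := .d) δ h₂ fun y hy => ?_
  rcases List.mem_append.1 hy with hy | hy
  · rcases List.mem_append.1 hy with hy | hy <;> simp [eq_of_core_mem_blocks hy, Letter.index]
  · simp [eq_of_core_mem_blocks hy, Letter.index]

theorem count_a_eq_of_mem_CSDStrings {w : List Token} (hw : w ∈ CSDStrings) :
    w.count (.core .a) = w.count (.core .c) := by
  obtain ⟨α, β, γ, δ, -, -, h, -, rfl⟩ := hw
  simp [count_core_blocks, h]

theorem count_b_eq_of_mem_CSDStrings {w : List Token} (hw : w ∈ CSDStrings) :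
    w.count (.core .b) = w.count (.core .d) := by
  obtain ⟨α, β, γ, δ, -, -, -, h, rfl⟩ := hw
  simp [count_core_blocks, h]

theorem count_pos_of_mem_CSDStrings {w : List Token} (hw : w ∈ CSDStrings) (x : Letter) :
    0 < w.count (.core x) := by
  obtain ⟨α, β, γ, δ, hα, hβ, h, h', rfl⟩ := hw
  have := List.length_pos_of_ne_nil hα
  have := List.length_pos_of_ne_nil hβ
  cases x <;> simp [count_core_blocks] <;> omega

/-- The yield of `s` is a contiguous factor of the whole string. A `y` to its left would precede the
`x` in it, and a `y` to its right would follow the `z` in it only by breaking the order. -/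
theorem CoreSorted.count_context_eq_zero {lex : S.Sym → Option Token} {D : Ctx S} {s : Tree S}
    (h : CoreSorted ((D.fill s).yield lex)) {x y z : Letter} (hxy : x.index < y.index)
    (hyz : y.index < z.index) (hx : 0 < (s.yield lex).count (.core x))
    (hz : 0 < (s.yield lex).count (.core z)) : (D.yield lex).count (.core y) = 0 := by
  rw [List.count_pos_iff] at hx hz
  rw [Ctx.yield_fill, CoreSorted, List.pairwise_append, List.pairwise_append] at h
  obtain ⟨⟨-, -, h₁⟩, -, h₂⟩ := h
  rw [List.count_eq_zero, Ctx.yield, List.mem_append]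
  rintro (hy | hy)
  · have := h₁ _ hy _ hx _ _ rfl rfl
    omega
  · have := h₂ _ (List.mem_append_right _ hz) _ hy _ _ rfl rfl
    omega

/-! Separation -/

section Separation

variable (lex : S.Sym → Option Token)

/-- The number of occurrences of a core letter in the yield of a tree. -/
abbrev Tree.cnt (x : Letter) (t : Tree S) : ℕ := (t.yield lex).count (.core x)

/-- The number of occurrences of a core letter in the yield of a context. -/
abbrev Ctx.cnt (x : Letter) (C : Ctx S) : ℕ := (C.yield lex).count (.core x)

/-- All letters `y` are in `s`. The path in `s` to a leaf with token `y` splits `s` into the middle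
context and a tree without `x`. -/
theorem isSeparated_of_subtree {x y : Letter} (hxy : x ≠ y) {l : ℕ} {D : Ctx S} {s : Tree S}
    (hD : D.cnt lex y = 0) (hs : s.cnt lex x ≤ l) (hy : 0 < (D.fill s).cnt lex y) :
    IsSeparated lex x y l (D.fill s) := by
  have hys : 0 < s.cnt lex y := by
    rw [Tree.cnt, Ctx.count_fill] at hy
    rw [Ctx.cnt] at hD
    rw [Tree.cnt]
    omega
  obtain ⟨D₀, u, rfl, hu⟩ := exists_leaf_of_count_pos lex (x := Token.core x) (by simpa using hxy)
    s hys
  refine ⟨D, D₀, u, rfl, hD, ?_, hu⟩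
  rw [Tree.cnt, Ctx.count_fill] at hs
  omega

/-- Below the root of `node f ts` there are more than `l` letters `a` and more than `l` letters `d`,
but no child of the root has letters of both kinds of one of the pairs `a, c` and `b, d` and
`a, d`. -/
structure IsSpread (l : ℕ) (f : S.Sym) (ts : Fin (S.rank f) → Tree S) : Prop where
  lt_a : l < (Tree.node f ts).cnt lex .a
  lt_d : l < (Tree.node f ts).cnt lex .d
  ac : ∀ j, (ts j).cnt lex .a = 0 ∨ (ts j).cnt lex .c = 0
  bd : ∀ j, (ts j).cnt lex .b = 0 ∨ (ts j).cnt lex .d = 0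
  ad : ∀ j, (ts j).cnt lex .a = 0 ∨ (ts j).cnt lex .d = 0

/-- All letters `b` and `c` of `t` are below a node at which the letters spread. -/
def HasSpread (l : ℕ) (t : Tree S) : Prop :=
  ∃ (D : Ctx S) (f : S.Sym) (ts : Fin (S.rank f) → Tree S), t = D.fill (.node f ts) ∧
    D.cnt lex .b = 0 ∧ D.cnt lex .c = 0 ∧ IsSpread lex l f ts

/-- Descend as long as some child still contains every `x` of the tree. -/
theorem exists_minimal_subtree (x : Letter) (s : Tree S) : ∀ D : Ctx S, D.cnt lex x = 0 →
    ∃ (D' : Ctx S) (f : S.Sym) (ts : Fin (S.rank f) → Tree S), D.fill s = D'.fill (.node f ts) ∧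
      D'.cnt lex x = 0 ∧ ∀ j, (D'.comp (Ctx.around f ts j)).cnt lex x ≠ 0 := by
  induction s with
  | node f ts ih =>
    intro D hD
    by_cases h : ∃ j, (D.comp (Ctx.around f ts j)).cnt lex x = 0
    · obtain ⟨j, hj⟩ := h
      obtain ⟨D', g, us, h₁, h₂⟩ := ih j _ hj
      exact ⟨D', g, us, by rw [← h₁, Ctx.fill_comp, Ctx.around_fill_self], h₂⟩
    · exact ⟨D, f, ts, rfl, hD, not_exists.1 h⟩

theorem hasSpread_of_not_isSeparated {l : ℕ} {t : Tree S} (ht : t.yield lex ∈ CSDStrings)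
    (hac : ¬ IsSeparated lex .a .c l t) (hdb : ¬ IsSeparated lex .d .b l t) :
    HasSpread lex l t := by
  obtain ⟨D, f, ts, htD, hb, hmin⟩ := exists_minimal_subtree lex .b t .hole rfl
  change t = _ at htD
  have hsort := coreSorted_of_mem_CSDStrings ht
  have hpos := fun x => count_pos_of_mem_CSDStrings ht x
  have hd : ∀ (E : Ctx S) (s : Tree S), t = E.fill s → E.cnt lex .b = 0 → l < s.cnt lex .d := by
    rintro E s rfl hE
    by_contra! h
    exact hdb (isSeparated_of_subtree lex (by decide) hE h (hpos _))
  have ha : ∀ (E : Ctx S) (s : Tree S), t = E.fill s → E.cnt lex .c = 0 → l < s.cnt lex .a := by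
    rintro E s rfl hE
    by_contra! h
    exact hac (isSeparated_of_subtree lex (by decide) hE h (hpos _))
  have hbet : ∀ (E : Ctx S) (s : Tree S), t = E.fill s → ∀ x y z : Letter, x.index < y.index →
      y.index < z.index → 0 < s.cnt lex x → 0 < s.cnt lex z → E.cnt lex y = 0 := by
    rintro E s rfl x y z hxy hyz hx hz
    exact hsort.count_context_eq_zero hxy hyz hx hz
  have hbs : 0 < (Tree.node f ts).cnt lex .b := by
    have := hpos .b
    rw [htD, Ctx.count_fill] at this
    rw [Ctx.cnt] at hb
    rw [Tree.cnt]
    omega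
  have hds := hd _ _ htD hb
  have hc : D.cnt lex .c = 0 :=
    hbet _ _ htD .b .c .d (by decide) (by decide) hbs (by omega)
  have hchild : ∀ j, t = (D.comp (Ctx.around f ts j)).fill (ts j) := fun j => by
    rw [Ctx.fill_comp, Ctx.around_fill_self, htD]
  -- The choice of the node concerns `b` only. A child that had every `c` would also have an `a`,
  -- because `t` is not `a,c`-separated, and then every `b` in between.
  have hmin' : ∀ j, (D.comp (Ctx.around f ts j)).cnt lex .c ≠ 0 := fun j h => by
    have h₁ := ha _ _ (hchild j) h
    refine hmin j (hbet _ _ (hchild j) .a .b .c (by decide) (by decide) (by omega) ?_)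
    have h₂ := hpos .c
    rw [hchild j, Ctx.count_fill] at h₂
    rw [Ctx.cnt] at h
    rw [Tree.cnt]
    omega
  refine ⟨D, f, ts, htD, hb, hc, ha _ _ htD hc, hds, fun j => ?_, fun j => ?_, fun j => ?_⟩ <;>
    by_contra! h
  · exact hmin j (hbet _ _ (hchild j) .a .b .c (by decide) (by decide) (by omega) (by omega))
  · exact hmin' j (hbet _ _ (hchild j) .b .c .d (by decide) (by decide) (by omega) (by omega))
  · exact hmin j (hbet _ _ (hchild j) .a .b .d (by decide) (by decide) (by omega) (by omega))

/-- `W` may be replaced by `V`, as far as the numbers of core letters are concerned: `W` has at most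
`l` letters of each kind, and in passing to `V` the letters `a, c` and `b, d` are erased in
pairs. -/
structure Shrinks (l : ℕ) (W V : Ctx S) : Prop where
  cnt_le : ∀ x, W.cnt lex x ≤ l
  le : ∀ x, V.cnt lex x ≤ W.cnt lex x
  ac : W.cnt lex .a + V.cnt lex .c = W.cnt lex .c + V.cnt lex .a
  bd : W.cnt lex .b + V.cnt lex .d = W.cnt lex .d + V.cnt lex .b

variable {lex} {l : ℕ} {W V : Ctx S}

/-- Letters are erased in pairs, so a pair of which one letter is missing in `W` loses nothing. -/
theorem Shrinks.cnt_eq (h : Shrinks lex l W V)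
    (hac : W.cnt lex .a = 0 ∨ W.cnt lex .c = 0) (hbd : W.cnt lex .b = 0 ∨ W.cnt lex .d = 0)
    (x : Letter) : V.cnt lex x = W.cnt lex x := by
  have ha := h.le .a
  have hb := h.le .b
  have hc := h.le .c
  have hd := h.le .d
  have h₁ := h.ac
  have h₂ := h.bd
  cases x <;> omega

/-- A context with at most `l` letters of each kind is too poor to contain the spread node on its
spine or in a side tree, so the node lies in what fills the hole. -/
theorem IsSpread.exists_factor {f : S.Sym} {ts : Fin (S.rank f) → Tree S}
    (hs : IsSpread lex l f ts) (W : Ctx S) (hW : ∀ x, W.cnt lex x ≤ l) :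
    ∀ (D : Ctx S) (t₅ : Tree S), W.fill t₅ = D.fill (.node f ts) →
      ∃ F : Ctx S, t₅ = F.fill (.node f ts) ∧ D = W.comp F := by
  induction W with
  | hole => exact fun D t₅ h => ⟨D, h, rfl⟩
  | node g i us W ih =>
    have hg : Ctx.node g i us W = (Ctx.node g i us .hole).comp W := rfl
    have hW' : ∀ x, W.cnt lex x ≤ l := fun x => by
      have := hW x
      rw [hg, Ctx.cnt, Ctx.count_comp] at this
      rw [Ctx.cnt]
      omega
    rintro (_ | ⟨g', i', us', D⟩) t₅ h
    -- The spread node is on the spine of `W`. It has more than `l` letters `a` and `d` but `W`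
    -- supplies at most `l` of each, so `t₅` has both, and so has the child containing `t₅`, against
    -- `IsSpread.ad`.
    · simp only [Ctx.fill] at h
      cases h
      have hi := hs.ad i
      simp only [dite_true] at hi
      have ha := hs.lt_a
      have hd := hs.lt_d
      have hWa := hW .a
      have hWd := hW .d
      change l < ((Ctx.node f i us W).fill t₅).cnt lex .a at ha
      change l < ((Ctx.node f i us W).fill t₅).cnt lex .d at hd
      rw [Tree.cnt, Ctx.count_fill] at ha hd
      rw [Tree.cnt, Tree.cnt, Ctx.count_fill, Ctx.count_fill] at hi
      rw [Ctx.cnt] at hWa hWd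
      omega
    · simp only [Ctx.fill] at h
      injection h with h₁ h₂
      subst h₁
      have h₂ := congrFun (eq_of_heq h₂)
      by_cases hi : i' = i
      · subst hi
        have h₃ := h₂ i'
        simp only [dite_true] at h₃
        obtain ⟨F, hF, hD⟩ := ih hW' D t₅ h₃
        refine ⟨F, hF, ?_⟩
        subst hD
        simp only [Ctx.comp]
        congr 1
        funext j
        have := h₂ j.1
        rw [dif_neg j.2, dif_neg j.2] at this
        exact this.symm
      -- The spread node is in a side tree of `W`, which would give `W` more than `l` letters `a`.
      · have h₃ := h₂ i'
        rw [dif_neg hi, dif_pos rfl] at h₃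
        have ha := hs.lt_a
        have hWa := hW .a
        exfalso
        have h₄ : (us ⟨i', hi⟩).cnt lex .a ≤ (Ctx.node _ i us W).cnt lex .a :=
          Ctx.count_side_le lex _ _ i us W ⟨i', hi⟩
        rw [h₃, Tree.cnt, Ctx.count_fill] at h₄
        rw [Tree.cnt] at ha
        omega

/-- Spreading depends only on the letter counts of the children. -/
theorem IsSpread.update {f : S.Sym} {ts : Fin (S.rank f) → Tree S} (hs : IsSpread lex l f ts)
    {i : Fin (S.rank f)} {u : Tree S} (hu : ∀ x, u.cnt lex x = (ts i).cnt lex x) :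
    IsSpread lex l f (Function.update ts i u) := by
  have hchild : ∀ x j, (Function.update ts i u j).cnt lex x = (ts j).cnt lex x := fun x j => by
    by_cases hj : j = i
    · subst hj
      rw [Function.update_self, hu]
    · rw [Function.update_of_ne hj]
  have hnode : ∀ x, (Tree.node f (Function.update ts i u)).cnt lex x =
      (Tree.node f ts).cnt lex x := fun x => by
    rw [← Ctx.around_fill, ← Ctx.around_fill_self f ts i, Tree.cnt, Tree.cnt, Ctx.count_fill,
      Ctx.count_fill]
    exact congrArg _ (hu x)
  constructor <;> simp only [hchild, hnode]
  · exact hs.lt_a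
  · exact hs.lt_d
  · exact hs.ac
  · exact hs.bd
  · exact hs.ad

theorem HasSpread.fill {t : Tree S} (h : HasSpread lex l t) {E : Ctx S} (hb : E.cnt lex .b = 0)
    (hc : E.cnt lex .c = 0) : HasSpread lex l (E.fill t) := by
  obtain ⟨D, f, ts, rfl, hb', hc', hs⟩ := h
  refine ⟨E.comp D, f, ts, by rw [Ctx.fill_comp], ?_, ?_, hs⟩ <;>
  · rw [Ctx.cnt, Ctx.count_comp]
    rw [Ctx.cnt] at *
    omega

theorem node_fill_eq_update {f : S.Sym} {i : Fin (S.rank f)}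
    {us : {j : Fin (S.rank f) // j ≠ i} → Tree S} {ts : Fin (S.rank f) → Tree S} {C : Ctx S}
    {t t' : Tree S} (h : (Ctx.node f i us C).fill t = .node f ts) :
    ts i = C.fill t ∧ (Ctx.node f i us C).fill t' = .node f (Function.update ts i (C.fill t')) := by
  simp only [Ctx.fill] at h
  cases h
  refine ⟨dif_pos rfl, ?_⟩
  simp only [Ctx.fill]
  congr 1
  funext j
  rw [Function.update_apply]
  split_ifs <;> rfl

/-- The paths to `W` and to the spread node are compared from the root. The path to `W` ends first,
or it passes through the spread node, or the two paths diverge. -/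
theorem HasSpread.shrink (hVW : Shrinks lex l W V) : ∀ {C₁ : Ctx S} {t₅ : Tree S},
    HasSpread lex l (C₁.fill (W.fill t₅)) → HasSpread lex l (C₁.fill (V.fill t₅)) := by
  suffices H : ∀ (D : Ctx S) (f : S.Sym) (ts : Fin (S.rank f) → Tree S), IsSpread lex l f ts →
      ∀ (C₁ : Ctx S) (t₅ : Tree S), C₁.fill (W.fill t₅) = D.fill (.node f ts) →
      D.cnt lex .b = 0 → D.cnt lex .c = 0 → HasSpread lex l (C₁.fill (V.fill t₅)) by
    rintro C₁ t₅ ⟨D, f, ts, h, hb, hc, hs⟩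
    exact H D f ts hs C₁ t₅ h hb hc
  intro D f ts hs
  -- The spread node is inside `W.fill t₅`, hence inside `t₅` by `IsSpread.exists_factor`; replacing
  -- `W` by `V` adds no `b` or `c` above it.
  have hroot : ∀ (D : Ctx S) (t₅ : Tree S), W.fill t₅ = D.fill (.node f ts) →
      D.cnt lex .b = 0 → D.cnt lex .c = 0 → HasSpread lex l (V.fill t₅) := by
    intro D t₅ h hb hc
    obtain ⟨F, rfl, rfl⟩ := hs.exists_factor W hVW.cnt_le D t₅ h
    rw [Ctx.cnt, Ctx.count_comp] at hb hc
    have hVb := hVW.le .b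
    have hVc := hVW.le .c
    rw [Ctx.cnt, Ctx.cnt] at hVb hVc
    refine HasSpread.fill ⟨F, f, ts, rfl, ?_, ?_, hs⟩ ?_ ?_ <;> rw [Ctx.cnt] <;> omega
  -- A subtree around `W` that lacks a letter of each pair keeps all its counts.
  have hequal : ∀ (C₁ : Ctx S) (t₅ s : Tree S), s = C₁.fill (W.fill t₅) →
      (s.cnt lex .a = 0 ∨ s.cnt lex .c = 0) → (s.cnt lex .b = 0 ∨ s.cnt lex .d = 0) →
      ∀ x, (C₁.fill (V.fill t₅)).cnt lex x = s.cnt lex x := by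
    rintro C₁ t₅ s rfl hac hbd x
    simp only [Tree.cnt, Ctx.count_fill] at hac hbd ⊢
    have := hVW.cnt_eq (by simp only [Ctx.cnt]; omega) (by simp only [Ctx.cnt]; omega) x
    rw [Ctx.cnt, Ctx.cnt] at this
    rw [this]
  induction D with
  | hole =>
    rintro (_ | ⟨g, i, us, C₁⟩) t₅ h hb hc
    · exact hroot _ t₅ h hb hc
    · have hg : g = f := by
        simp only [Ctx.fill] at h
        injection h
      subst hg
      obtain ⟨h₁, h₂⟩ := node_fill_eq_update (t' := V.fill t₅) h
      rw [h₂]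
      exact ⟨.hole, g, _, rfl, rfl, rfl,
        hs.update (hequal C₁ t₅ _ h₁ (hs.ac i) (hs.bd i))⟩
  | node g i us D ih =>
    rintro (_ | ⟨g', i', us', C₁⟩) t₅ h hb hc
    · exact hroot _ t₅ h hb hc
    · have hg : g' = g := by
        simp only [Ctx.fill] at h
        injection h
      subst hg
      have h' := h
      simp only [Ctx.fill] at h'
      injection h' with _ h'
      have h' := congrFun h'
      have hcomp : Ctx.node g' i us D = (Ctx.node g' i us .hole).comp D := rfl
      by_cases hi : i = i'
      · subst hi
        have h₁ := h' i
        simp only [dite_true] at h₁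
        have h₂ : ∀ x, (Ctx.node g' i us .hole).cnt lex x + D.cnt lex x =
            (Ctx.node g' i us D).cnt lex x := fun x => by
          rw [hcomp, Ctx.cnt, Ctx.cnt, Ctx.cnt, Ctx.count_comp]
        have hus : us' = us := by
          funext j
          have := h' j.1
          rwa [dif_neg j.2, dif_neg j.2] at this
        have := (ih C₁ t₅ h₁ (by have := h₂ .b; omega) (by have := h₂ .c; omega)).fill
          (E := Ctx.node g' i us .hole) (by have := h₂ .b; omega) (by have := h₂ .c; omega)
        rw [hus]
        exact this
      -- The paths diverge here: `W` is in a side tree of the context above the spread node. That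
      -- context has neither `b` nor `c`, so `hequal` applies.
      · have h₁ := h' i'
        rw [dif_pos rfl, dif_neg (Ne.symm hi)] at h₁
        have h₂ := fun x => Ctx.count_side_le lex (Token.core x) g' i us D ⟨i', Ne.symm hi⟩
        have heq := hequal C₁ t₅ _ h₁.symm
          (.inr (by have := h₂ .c; simp only [Ctx.cnt, Tree.cnt] at *; omega))
          (.inl (by have := h₂ .b; simp only [Ctx.cnt, Tree.cnt] at *; omega))
        set us₂ : {j // j ≠ i} → Tree S :=
          Function.update us ⟨i', Ne.symm hi⟩ (C₁.fill (V.fill t₅)) with hus₂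
        have key : (Ctx.node g' i' us' C₁).fill (V.fill t₅) =
            (Ctx.node g' i us₂ D).fill (.node f ts) := by
          simp only [Ctx.fill]
          congr 1
          funext j
          by_cases hj : j = i'
          · subst hj
            rw [dif_pos rfl, dif_neg (Ne.symm hi), hus₂, Function.update_self]
          · have h₃ := h' j
            rw [dif_neg hj] at h₃ ⊢
            rw [h₃]
            by_cases hji : j = i
            · rw [dif_pos hji, dif_pos hji]
            · rw [dif_neg hji, dif_neg hji, hus₂, Function.update_of_ne]
              simpa using hj
        -- The counts of the changed context follow by cancelling the spread node from the counts of
        -- the whole trees.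
        have hcnt : ∀ x, (Ctx.node g' i us₂ D).cnt lex x = (Ctx.node g' i us D).cnt lex x := by
          intro x
          have h₃ : ((Ctx.node g' i' us' C₁).fill (V.fill t₅)).cnt lex x =
              ((Ctx.node g' i' us' C₁).fill (W.fill t₅)).cnt lex x := by
            have h₄ : ∀ t, (Ctx.node g' i' us' C₁).fill t =
                (Ctx.node g' i' us' .hole).fill (C₁.fill t) := fun _ => rfl
            rw [h₄, h₄, Tree.cnt, Tree.cnt, Ctx.count_fill _ _ (Ctx.node g' i' us' .hole),
              Ctx.count_fill _ _ (Ctx.node g' i' us' .hole), h₁]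
            exact congrArg _ (heq x)
          rw [key, h, Tree.cnt, Tree.cnt, Ctx.count_fill, Ctx.count_fill] at h₃
          rw [Ctx.cnt, Ctx.cnt]
          omega
        exact ⟨_, f, ts, key, by rw [hcnt, hb], by rw [hcnt, hc], hs⟩

/-- A language of trees with the yields of cross-serial dependencies has no tree at which the
letters spread, if contexts up to a pumping height of the language generate at most `l` tokens. -/
theorem IsPumpingHeight.not_hasSpread {T : Set (Tree S)} {p : ℕ} (hp : IsPumpingHeight T p)
    (hT : ∀ t ∈ T, t.yield lex ∈ CSDStrings)
    (hl : ∀ C : Ctx S, C.height ≤ p → (C.yield lex).length ≤ l) :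
    ∀ t ∈ T, ¬ HasSpread lex l t := by
  suffices H : ∀ n, ∀ t ∈ T, t.size = n → ¬ HasSpread lex l t from fun t ht => H _ t ht rfl
  intro n
  induction n using Nat.strong_induction_on with
  | _ n ih =>
  intro t ht hn hspread
  by_cases hh : p < t.height
  · obtain ⟨C₁, C₂, C₃, C₄, t₅, rfl, hht, hpos, hpump⟩ := hp t ht hh
    -- Only the zeroth power is needed: it replaces `C₂[C₃[C₄]]` by `C₃`.
    have h₀ := hpump 0
    simp only [pump] at h₀
    refine ih _ ?_ _ h₀ rfl (HasSpread.shrink (W := C₂.comp (C₃.comp C₄)) ?_ ?_)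
    · rw [← hn]
      exact size_pump_zero_lt C₁ t₅ hpos
    · have h₁ := hT _ ht
      have h₂ := hT _ h₀
      have e₁ := count_a_eq_of_mem_CSDStrings h₁
      have e₂ := count_a_eq_of_mem_CSDStrings h₂
      have e₃ := count_b_eq_of_mem_CSDStrings h₁
      have e₄ := count_b_eq_of_mem_CSDStrings h₂
      simp only [Ctx.count_fill] at e₁ e₂ e₃ e₄
      constructor
      · exact fun x => List.count_le_length.trans (hl _ hht)
      all_goals simp only [Ctx.cnt, Ctx.count_comp]
      · intro x
        omega
      · omega
      · omega
    · simpa only [Ctx.fill_comp] using hspread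
  -- In a tree of height at most `p`, the context around a leaf with token `b` also has height at
  -- most `p`, yet it generates every `a` of the tree.
  · obtain ⟨D, f, ts, rfl, -, -, hs⟩ := hspread
    obtain ⟨E, u, hE, hu⟩ := exists_leaf_of_count_pos lex (x := Token.core .a)
      (y := Token.core .b) (by decide) _ (count_pos_of_mem_CSDStrings (hT _ ht) .b)
    have h₁ := hs.lt_a
    have h₂ : (D.fill (.node f ts)).cnt lex .a = (E.fill u).cnt lex .a := by rw [hE]
    rw [Tree.cnt, Tree.cnt, Ctx.count_fill, Ctx.count_fill, hu] at h₂
    rw [Tree.cnt] at h₁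
    have h₃ := E.height_le_fill u
    rw [← hE] at h₃
    have h₄ := hl E (by omega)
    have h₅ := List.count_le_length (a := Token.core .a) (l := E.yield lex)
    omega

end Separation

-- Derivation trees of the grammar

namespace LMCFTG

variable (G : LMCFTG S)

mutual

/-- `G.DerTree n s t`: the sentential form `s` derives the terminal tree `t`, by a derivation tree of
height at most `n`. -/
inductive DerTree : ℕ → Tree (S.extend G.N₀ G.N₁) → Tree S → Prop
  | term (n : ℕ) (f : S.Sym) (ts : Fin (S.rank f) → Tree (S.extend G.N₀ G.N₁))
      (ts' : Fin (S.rank f) → Tree S) (h : ∀ j, DerTree n (ts j) (ts' j)) :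
      DerTree (n + 1) (.node (S := S.extend G.N₀ G.N₁) (Sum.inr f) ts) (.node f ts')
  | nt₀ (n : ℕ) (A : G.N₀) (ts : Fin 0 → Tree (S.extend G.N₀ G.N₁))
      (r : Tree (S.extend G.N₀ G.N₁)) (t : Tree S) (hr : (A, r) ∈ G.rules₀) (h : DerTree n r t) :
      DerTree (n + 1) (.node (S := S.extend G.N₀ G.N₁) (Sum.inl (Sum.inl A)) ts) t
  | nt₁ (n : ℕ) (A : G.N₁) (ts : Fin 1 → Tree (S.extend G.N₀ G.N₁))
      (R : Ctx (S.extend G.N₀ G.N₁)) (C : Ctx S) (t : Tree S) (hR : (A, R) ∈ G.rules₁)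
      (h : DerCtx n R C) (h' : DerTree n (ts 0) t) :
      DerTree (n + 1) (.node (S := S.extend G.N₀ G.N₁) (Sum.inl (Sum.inr A)) ts) (C.fill t)

/-- `G.DerCtx n R C`: the context `R` over terminals and nonterminals derives the terminal context
`C`, by a derivation tree of height at most `n`. -/
inductive DerCtx : ℕ → Ctx (S.extend G.N₀ G.N₁) → Ctx S → Prop
  | hole (n : ℕ) : DerCtx (n + 1) .hole .hole
  | term (n : ℕ) (f : S.Sym) (i : Fin (S.rank f))
      (ts : {j : Fin (S.rank f) // j ≠ i} → Tree (S.extend G.N₀ G.N₁))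
      (ts' : {j : Fin (S.rank f) // j ≠ i} → Tree S)
      (K : Ctx (S.extend G.N₀ G.N₁)) (C : Ctx S)
      (h : ∀ j, DerTree n (ts j) (ts' j)) (h' : DerCtx n K C) :
      DerCtx (n + 1) (.node (S := S.extend G.N₀ G.N₁) (Sum.inr f) i ts K) (.node f i ts' C)
  | nt₁ (n : ℕ) (A : G.N₁) (i : Fin 1) (ts : {j : Fin 1 // j ≠ i} → Tree (S.extend G.N₀ G.N₁))
      (R K : Ctx (S.extend G.N₀ G.N₁)) (C C' : Ctx S) (hR : (A, R) ∈ G.rules₁)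
      (h : DerCtx n R C) (h' : DerCtx n K C') :
      DerCtx (n + 1) (.node (S := S.extend G.N₀ G.N₁) (Sum.inl (Sum.inr A)) i ts K) (C.comp C')

end

variable {G}

theorem der_succ (n : ℕ) : (∀ s t, G.DerTree n s t → G.DerTree (n + 1) s t) ∧
    ∀ R C, G.DerCtx n R C → G.DerCtx (n + 1) R C := by
  induction n with
  | zero => exact ⟨fun s t h => (nomatch h), fun R C h => (nomatch h)⟩
  | succ n ih =>
    constructor
    · rintro s t (⟨_, f, ts, ts', h⟩ | ⟨_, A, ts, r, _, hr, h⟩ | ⟨_, A, ts, R, C, t, hR, h, h'⟩)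
      · exact .term _ f ts ts' fun j => ih.1 _ _ (h j)
      · exact .nt₀ _ A ts r t hr (ih.1 _ _ h)
      · exact .nt₁ _ A ts R C t hR (ih.2 _ _ h) (ih.1 _ _ h')
    · rintro R C (_ | ⟨_, f, i, ts, ts', K, C, h, h'⟩ | ⟨_, A, i, ts, R, K, C, C', hR, h, h'⟩)
      · exact .hole _
      · exact .term _ f i ts ts' K C (fun j => ih.1 _ _ (h j)) (ih.2 _ _ h')
      · exact .nt₁ _ A i ts R K C C' hR (ih.2 _ _ h) (ih.2 _ _ h')

theorem DerTree.mono {m n : ℕ} (hmn : m ≤ n) {s : Tree (S.extend G.N₀ G.N₁)} {t : Tree S}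
    (h : G.DerTree m s t) : G.DerTree n s t := by
  induction hmn with
  | refl => exact h
  | step _ ih => exact (der_succ _).1 _ _ ih

theorem DerCtx.mono {m n : ℕ} (hmn : m ≤ n) {R : Ctx (S.extend G.N₀ G.N₁)} {C : Ctx S}
    (h : G.DerCtx m R C) : G.DerCtx n R C := by
  induction hmn with
  | refl => exact h
  | step _ ih => exact (der_succ _).2 _ _ ih

variable (G)

/-- The sentential form `s` derives the terminal tree `t`. -/
def Gen (s : Tree (S.extend G.N₀ G.N₁)) (t : Tree S) : Prop := ∃ n, G.DerTree n s t

/-- The context `R` over terminals and nonterminals derives the terminal context `C`. -/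
def GenCtx (R : Ctx (S.extend G.N₀ G.N₁)) (C : Ctx S) : Prop := ∃ n, G.DerCtx n R C

variable {G}

theorem exists_common_fuel {ι : Type} [Finite ι] {s : ι → Tree (S.extend G.N₀ G.N₁)}
    {t : ι → Tree S} (h : ∀ j, G.Gen (s j) (t j)) : ∃ n, ∀ j, G.DerTree n (s j) (t j) := by
  choose n hn using h
  obtain ⟨N, hN⟩ := (Set.finite_range n).bddAbove
  exact ⟨N, fun j => (hn j).mono (hN ⟨j, rfl⟩)⟩

theorem Gen.term {f : S.Sym} {ts : Fin (S.rank f) → Tree (S.extend G.N₀ G.N₁)}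
    {ts' : Fin (S.rank f) → Tree S} (h : ∀ j, G.Gen (ts j) (ts' j)) :
    G.Gen (.node (S := S.extend G.N₀ G.N₁) (Sum.inr f) ts) (.node f ts') := by
  obtain ⟨n, hn⟩ := exists_common_fuel h
  exact ⟨_, .term n f ts ts' hn⟩

theorem Gen.nt₀ {A : G.N₀} {ts : Fin 0 → Tree (S.extend G.N₀ G.N₁)}
    {r : Tree (S.extend G.N₀ G.N₁)} {t : Tree S} (hr : (A, r) ∈ G.rules₀) (h : G.Gen r t) :
    G.Gen (.node (S := S.extend G.N₀ G.N₁) (Sum.inl (Sum.inl A)) ts) t := by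
  obtain ⟨n, hn⟩ := h
  exact ⟨_, .nt₀ n A ts r t hr hn⟩

theorem Gen.nt₁ {A : G.N₁} {ts : Fin 1 → Tree (S.extend G.N₀ G.N₁)}
    {R : Ctx (S.extend G.N₀ G.N₁)} {C : Ctx S} {t : Tree S} (hR : (A, R) ∈ G.rules₁)
    (h : G.GenCtx R C) (h' : G.Gen (ts 0) t) :
    G.Gen (.node (S := S.extend G.N₀ G.N₁) (Sum.inl (Sum.inr A)) ts) (C.fill t) := by
  obtain ⟨n, hn⟩ := h
  obtain ⟨m, hm⟩ := h'
  exact ⟨_, .nt₁ (max n m) A ts R C t hR (hn.mono (le_max_left _ _)) (hm.mono (le_max_right _ _))⟩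

theorem GenCtx.hole : G.GenCtx .hole .hole := ⟨_, .hole 0⟩

theorem GenCtx.term {f : S.Sym} {i : Fin (S.rank f)}
    {ts : {j : Fin (S.rank f) // j ≠ i} → Tree (S.extend G.N₀ G.N₁)}
    {ts' : {j : Fin (S.rank f) // j ≠ i} → Tree S}
    {K : Ctx (S.extend G.N₀ G.N₁)} {C : Ctx S}
    (h : ∀ j, G.Gen (ts j) (ts' j)) (h' : G.GenCtx K C) :
    G.GenCtx (.node (S := S.extend G.N₀ G.N₁) (Sum.inr f) i ts K) (.node f i ts' C) := by
  obtain ⟨n, hn⟩ := exists_common_fuel h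
  obtain ⟨m, hm⟩ := h'
  exact ⟨_, .term (max n m) f i ts ts' K C (fun j => (hn j).mono (le_max_left _ _))
    (hm.mono (le_max_right _ _))⟩

theorem GenCtx.nt₁ {A : G.N₁} {i : Fin 1} {ts : {j : Fin 1 // j ≠ i} → Tree (S.extend G.N₀ G.N₁)}
    {R K : Ctx (S.extend G.N₀ G.N₁)} {C C' : Ctx S} (hR : (A, R) ∈ G.rules₁)
    (h : G.GenCtx R C) (h' : G.GenCtx K C') :
    G.GenCtx (.node (S := S.extend G.N₀ G.N₁) (Sum.inl (Sum.inr A)) i ts K) (C.comp C') := by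
  obtain ⟨n, hn⟩ := h
  obtain ⟨m, hm⟩ := h'
  exact ⟨_, .nt₁ (max n m) A i ts R K C C' hR (hn.mono (le_max_left _ _))
    (hm.mono (le_max_right _ _))⟩

/-! Derivation trees describe the language of the grammar -/

theorem gen_lift (t : Tree S) : G.Gen (t.lift G.N₀ G.N₁) t := by
  induction t with
  | node f ts ih => exact Gen.term ih

theorem Gen.fill_mono {r r' : Tree (S.extend G.N₀ G.N₁)} (hr : ∀ t, G.Gen r t → G.Gen r' t)
    (K : Ctx (S.extend G.N₀ G.N₁)) : ∀ t, G.Gen (K.fill r) t → G.Gen (K.fill r') t := by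
  induction K with
  | hole => exact hr
  | node f i ts K ih =>
    have hchild : ∀ j t, G.Gen (if hj : j = i then K.fill r else ts ⟨j, hj⟩) t →
        G.Gen (if hj : j = i then K.fill r' else ts ⟨j, hj⟩) t := by
      intro j t h
      by_cases hj : j = i
      · rw [dif_pos hj] at h ⊢
        exact ih t h
      · rwa [dif_neg hj] at h ⊢
    rintro t ⟨n, h⟩
    simp only [Ctx.fill] at h ⊢
    generalize hus : (fun j => if hj : j = i then K.fill r else ts ⟨j, hj⟩) = us at h
    have hchild' : ∀ j t, G.Gen (us j) t →
        G.Gen (if hj : j = i then K.fill r' else ts ⟨j, hj⟩) t := by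
      subst hus
      exact hchild
    clear hus hchild
    cases h with
    | term n f _ ts' h => exact Gen.term fun j => hchild' _ _ ⟨_, h j⟩
    | nt₀ n A _ r₀ _ hr₀ h => exact Gen.nt₀ hr₀ ⟨_, h⟩
    | nt₁ n A _ R C t hR h h' => exact Gen.nt₁ hR ⟨_, h⟩ (hchild' _ _ ⟨_, h'⟩)

/-- Linearity is used here: `s` occurs once in `R.fill s` and is never copied or deleted, so its
derivation can be split off. -/
theorem Gen.exists_of_fill (R : Ctx (S.extend G.N₀ G.N₁)) (s : Tree (S.extend G.N₀ G.N₁)) :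
    ∀ t, G.Gen (R.fill s) t → ∃ C u, G.GenCtx R C ∧ G.Gen s u ∧ t = C.fill u := by
  induction R with
  | hole => exact fun t h => ⟨.hole, t, GenCtx.hole, h, rfl⟩
  | node f i ts K ih =>
    rintro t ⟨n, h⟩
    simp only [Ctx.fill] at h
    generalize hus : (fun j => if hj : j = i then K.fill s else ts ⟨j, hj⟩) = us at h
    have hi : us i = K.fill s := by
      rw [← hus]
      exact dif_pos rfl
    have hside : ∀ j : {j // j ≠ i}, us j.1 = ts j := by
      intro j
      rw [← hus]
      exact dif_neg j.2
    clear hus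
    cases h with
    | term n f _ ts' h =>
      obtain ⟨C, u, hC, hu, e⟩ := ih (ts' i) ⟨n, hi ▸ h i⟩
      refine ⟨.node f i (fun j => ts' j.1) C, u,
        GenCtx.term (fun j => ⟨n, hside j ▸ h j.1⟩) hC, hu, ?_⟩
      simp only [Ctx.fill]
      congr 1
      funext j
      by_cases hj : j = i
      · subst hj
        rw [dif_pos rfl, e]
      · rw [dif_neg hj]
    | nt₀ n A _ r₀ _ hr₀ h => exact (i : Fin 0).elim0
    | nt₁ n A _ R C t hR h h' =>
      have : i = (0 : Fin 1) := Subsingleton.elim (α := Fin 1) _ _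
      subst this
      obtain ⟨C', u, hC', hu, e⟩ := ih t ⟨n, hi ▸ h'⟩
      exact ⟨C.comp C', u, GenCtx.nt₁ hR ⟨n, h⟩ hC', hu, by rw [e, Ctx.fill_comp]⟩

theorem gen_of_step {s s' : Tree (S.extend G.N₀ G.N₁)} (h : G.Step s s') {t : Tree S}
    (ht : G.Gen s' t) : G.Gen s t := by
  cases h with
  | expand₀ K A r hr => exact Gen.fill_mono (fun t h => Gen.nt₀ hr h) K t ht
  | expand₁ K A R hR s =>
    refine Gen.fill_mono (fun t h => ?_) K t ht
    obtain ⟨C, u, hC, hu, rfl⟩ := Gen.exists_of_fill R s t h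
    exact Gen.nt₁ hR hC hu

theorem step_fill (K : Ctx (S.extend G.N₀ G.N₁)) {s s' : Tree (S.extend G.N₀ G.N₁)}
    (h : G.Step s s') : G.Step (K.fill s) (K.fill s') := by
  cases h with
  | expand₀ K' A r hr =>
    rw [← Ctx.fill_comp, ← Ctx.fill_comp]
    exact .expand₀ _ A r hr
  | expand₁ K' A R hR s =>
    rw [← Ctx.fill_comp, ← Ctx.fill_comp]
    exact .expand₁ _ A R hR s

theorem steps_fill (K : Ctx (S.extend G.N₀ G.N₁)) {s s' : Tree (S.extend G.N₀ G.N₁)}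
    (h : Relation.ReflTransGen G.Step s s') :
    Relation.ReflTransGen G.Step (K.fill s) (K.fill s') :=
  Relation.ReflTransGen.lift (fun s => K.fill s) (fun _ _ => step_fill K) _ _ h

/-- The children are rewritten one after another; `Finset.piecewise` records which of them are
finished. -/
theorem steps_node (f : (S.extend G.N₀ G.N₁).Sym)
    {ts ts' : Fin ((S.extend G.N₀ G.N₁).rank f) → Tree (S.extend G.N₀ G.N₁)}
    (h : ∀ j, Relation.ReflTransGen G.Step (ts j) (ts' j)) :
    Relation.ReflTransGen G.Step (.node f ts) (.node f ts') := by
  have H : ∀ A : Finset (Fin ((S.extend G.N₀ G.N₁).rank f)),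
      Relation.ReflTransGen G.Step (.node f ts) (.node f (A.piecewise ts' ts)) := by
    intro A
    induction A using Finset.induction_on with
    | empty => rw [Finset.piecewise_empty]
    | insert j A hj ih =>
      refine ih.trans ?_
      have := steps_fill (Ctx.around f (A.piecewise ts' ts) j) (h j)
      rw [Ctx.around_fill, Ctx.around_fill, ← Finset.piecewise_insert] at this
      rwa [show Function.update (A.piecewise ts' ts) j (ts j) = A.piecewise ts' ts by
        rw [Function.update_eq_self_iff, Finset.piecewise_eq_of_notMem _ _ _ hj]] at this
  simpa using H Finset.univ

theorem steps_of_der (n : ℕ) :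
    (∀ s t, G.DerTree n s t → Relation.ReflTransGen G.Step s (t.lift G.N₀ G.N₁)) ∧
    ∀ R C, G.DerCtx n R C → ∀ u v, Relation.ReflTransGen G.Step u (v.lift G.N₀ G.N₁) →
      Relation.ReflTransGen G.Step (R.fill u) ((C.fill v).lift G.N₀ G.N₁) := by
  induction n with
  | zero => exact ⟨fun s t h => (nomatch h), fun R C h => (nomatch h)⟩
  | succ n ih =>
    constructor
    · rintro s t (⟨_, f, ts, ts', h⟩ | ⟨_, A, ts, r, _, hr, h⟩ | ⟨_, A, ts, R, C, t, hR, h, h'⟩)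
      · exact steps_node (Sum.inr f) fun j => ih.1 _ _ (h j)
      · have hts : ts = Fin.elim0 := Subsingleton.elim _ _
        subst hts
        exact .head (.expand₀ .hole A r hr) (ih.1 _ _ h)
      · have hts : ts = fun _ => ts 0 := by
          funext j
          rw [Subsingleton.elim j 0]
        rw [hts]
        exact .head (.expand₁ .hole A R hR (ts 0)) (ih.2 _ _ h _ _ (ih.1 _ _ h'))
    · rintro R C (_ | ⟨_, f, i, ts, ts', K, C, h, h'⟩ | ⟨_, A, i, ts, R, K, C, C', hR, h, h'⟩)
        u v huv
      · exact huv
      · have key : ∀ j : Fin (S.rank f), Relation.ReflTransGen G.Step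
            (if hj : j = i then K.fill u else ts ⟨j, hj⟩)
            ((if hj : j = i then C.fill v else ts' ⟨j, hj⟩ : Tree S).lift G.N₀ G.N₁) := by
          intro j
          by_cases hj : j = i
          · rw [dif_pos hj, dif_pos hj]
            exact ih.2 _ _ h' _ _ huv
          · rw [dif_neg hj, dif_neg hj]
            exact ih.1 _ _ (h _)
        exact steps_node (Sum.inr f) key
      · have hfill : (Ctx.node (S := S.extend G.N₀ G.N₁) (Sum.inl (Sum.inr A)) i ts K).fill u =
            Tree.nt₁ A (K.fill u) := by
          simp only [Ctx.fill, Tree.nt₁]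
          congr 1
          funext j
          exact dif_pos (Subsingleton.elim (α := Fin 1) _ _)
        rw [hfill, Ctx.fill_comp]
        exact .head (.expand₁ .hole A R hR (K.fill u)) (ih.2 _ _ h _ _ (ih.2 _ _ h' _ _ huv))

theorem mem_language_iff_gen {t : Tree S} :
    t ∈ G.language ↔ G.Gen (Tree.nt₀ S G.N₁ G.start) t := by
  constructor
  · intro h
    change Relation.ReflTransGen G.Step _ _ at h
    generalize Tree.nt₀ S G.N₁ G.start = s at h ⊢
    induction h using Relation.ReflTransGen.head_induction_on with
    | refl => exact gen_lift t
    | head h _ ih => exact gen_of_step h ih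
  · rintro ⟨n, h⟩
    exact (steps_of_der n).1 _ _ h

end LMCFTG

/-! Subtrees and subcontexts -/

/-- The set of subtrees of a tree. -/
def Tree.subtrees : Tree S → Set (Tree S)
  | .node f ts => insert (.node f ts) (⋃ j, (ts j).subtrees)

/-- The set of those subtrees of a context that do not contain the hole. -/
def Ctx.subtrees : Ctx S → Set (Tree S)
  | .hole => ∅
  | .node _ _ ts C => (⋃ j, (ts j).subtrees) ∪ C.subtrees

/-- The set of lower parts of a context. -/
def Ctx.subcontexts : Ctx S → Set (Ctx S)
  | .hole => {.hole}
  | .node f i ts C => insert (.node f i ts C) C.subcontexts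

theorem Tree.finite_subtrees (t : Tree S) : t.subtrees.Finite := by
  induction t with
  | node f ts ih => exact (Set.finite_iUnion ih).insert _

theorem Ctx.finite_subtrees (C : Ctx S) : C.subtrees.Finite := by
  induction C with
  | hole => exact Set.finite_empty
  | node f i ts C ih => exact (Set.finite_iUnion fun j => (ts j).finite_subtrees).union ih

theorem Ctx.finite_subcontexts (C : Ctx S) : C.subcontexts.Finite := by
  induction C with
  | hole => exact Set.finite_singleton _
  | node f i ts C ih => exact ih.insert _

theorem Tree.self_mem_subtrees (t : Tree S) : t ∈ t.subtrees := by
  cases t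
  exact Set.mem_insert _ _

theorem Ctx.self_mem_subcontexts (C : Ctx S) : C ∈ C.subcontexts := by
  cases C
  · exact rfl
  · exact Set.mem_insert _ _

theorem Tree.child_mem_subtrees {t : Tree S} {f : S.Sym} {ts : Fin (S.rank f) → Tree S}
    (h : Tree.node f ts ∈ t.subtrees) (j : Fin (S.rank f)) : ts j ∈ t.subtrees := by
  induction t with
  | node g us ih =>
    rcases h with h | h
    · cases h
      exact Or.inr (Set.mem_iUnion.2 ⟨j, (ts j).self_mem_subtrees⟩)
    · obtain ⟨i, hi⟩ := Set.mem_iUnion.1 h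
      exact Or.inr (Set.mem_iUnion.2 ⟨i, ih i hi⟩)

theorem Ctx.child_mem_subtrees {C : Ctx S} {f : S.Sym} {ts : Fin (S.rank f) → Tree S}
    (h : Tree.node f ts ∈ C.subtrees) (j : Fin (S.rank f)) : ts j ∈ C.subtrees := by
  induction C with
  | hole => exact h.elim
  | node g i us C ih =>
    rcases h with h | h
    · obtain ⟨i, hi⟩ := Set.mem_iUnion.1 h
      exact Or.inl (Set.mem_iUnion.2 ⟨i, Tree.child_mem_subtrees hi j⟩)
    · exact Or.inr (ih h)

theorem Ctx.side_mem_subtrees {C : Ctx S} {f : S.Sym} {i : Fin (S.rank f)}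
    {ts : {j : Fin (S.rank f) // j ≠ i} → Tree S} {K : Ctx S}
    (h : Ctx.node f i ts K ∈ C.subcontexts) (j : {j : Fin (S.rank f) // j ≠ i}) :
    ts j ∈ C.subtrees := by
  induction C with
  | hole => cases h
  | node g i us C ih =>
    rcases h with h | h
    · cases h
      exact Or.inl (Set.mem_iUnion.2 ⟨j, (ts j).self_mem_subtrees⟩)
    · exact Or.inr (ih h)

theorem Ctx.spine_mem_subcontexts {C : Ctx S} {f : S.Sym} {i : Fin (S.rank f)}
    {ts : {j : Fin (S.rank f) // j ≠ i} → Tree S} {K : Ctx S}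
    (h : Ctx.node f i ts K ∈ C.subcontexts) : K ∈ C.subcontexts := by
  induction C with
  | hole => cases h
  | node g i us C ih =>
    rcases h with h | h
    · cases h
      exact Or.inr K.self_mem_subcontexts
    · exact Or.inr (ih h)

-- The finitely many states of derivations

namespace LMCFTG

variable (G : LMCFTG S)

/-- The subtrees of the right-hand sides of the rules, and the start symbol. -/
def treeStates : Set (Tree (S.extend G.N₀ G.N₁)) :=
  insert (Tree.nt₀ S G.N₁ G.start)
    ((⋃ ρ ∈ G.rules₀, ρ.2.subtrees) ∪ ⋃ ρ ∈ G.rules₁, ρ.2.subtrees)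

/-- The lower parts of the right-hand sides of the rules for nonterminals of rank one. -/
def ctxStates : Set (Ctx (S.extend G.N₀ G.N₁)) := ⋃ ρ ∈ G.rules₁, ρ.2.subcontexts

theorem finite_treeStates : G.treeStates.Finite :=
  ((G.finite_rules₀.biUnion fun ρ _ => ρ.2.finite_subtrees).union
    (G.finite_rules₁.biUnion fun ρ _ => ρ.2.finite_subtrees)).insert _

theorem finite_ctxStates : G.ctxStates.Finite :=
  G.finite_rules₁.biUnion fun ρ _ => ρ.2.finite_subcontexts

variable {G}

theorem mem_treeStates_of_rule {A : G.N₀} {r : Tree (S.extend G.N₀ G.N₁)}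
    (h : (A, r) ∈ G.rules₀) : r ∈ G.treeStates :=
  Or.inr (Or.inl (Set.mem_iUnion₂.2 ⟨_, h, r.self_mem_subtrees⟩))

theorem mem_ctxStates_of_rule {A : G.N₁} {R : Ctx (S.extend G.N₀ G.N₁)}
    (h : (A, R) ∈ G.rules₁) : R ∈ G.ctxStates :=
  Set.mem_iUnion₂.2 ⟨_, h, R.self_mem_subcontexts⟩

theorem child_mem_treeStates {f : (S.extend G.N₀ G.N₁).Sym}
    {ts : Fin ((S.extend G.N₀ G.N₁).rank f) → Tree (S.extend G.N₀ G.N₁)}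
    (h : Tree.node f ts ∈ G.treeStates) (j : Fin ((S.extend G.N₀ G.N₁).rank f)) :
    ts j ∈ G.treeStates := by
  rcases h with h | h | h
  · rw [Tree.nt₀] at h
    cases h
    exact (j : Fin 0).elim0
  · obtain ⟨ρ, hρ, h⟩ := Set.mem_iUnion₂.1 h
    exact Or.inr (Or.inl (Set.mem_iUnion₂.2 ⟨ρ, hρ, Tree.child_mem_subtrees h j⟩))
  · obtain ⟨ρ, hρ, h⟩ := Set.mem_iUnion₂.1 h
    exact Or.inr (Or.inr (Set.mem_iUnion₂.2 ⟨ρ, hρ, Ctx.child_mem_subtrees h j⟩))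

theorem side_mem_treeStates {f : (S.extend G.N₀ G.N₁).Sym}
    {i : Fin ((S.extend G.N₀ G.N₁).rank f)}
    {ts : {j : Fin ((S.extend G.N₀ G.N₁).rank f) // j ≠ i} → Tree (S.extend G.N₀ G.N₁)}
    {K : Ctx (S.extend G.N₀ G.N₁)} (h : Ctx.node f i ts K ∈ G.ctxStates)
    (j : {j : Fin ((S.extend G.N₀ G.N₁).rank f) // j ≠ i}) : ts j ∈ G.treeStates := by
  obtain ⟨ρ, hρ, h⟩ := Set.mem_iUnion₂.1 h
  exact Or.inr (Or.inr (Set.mem_iUnion₂.2 ⟨ρ, hρ, Ctx.side_mem_subtrees h j⟩))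

theorem spine_mem_ctxStates {f : (S.extend G.N₀ G.N₁).Sym}
    {i : Fin ((S.extend G.N₀ G.N₁).rank f)}
    {ts : {j : Fin ((S.extend G.N₀ G.N₁).rank f) // j ≠ i} → Tree (S.extend G.N₀ G.N₁)}
    {K : Ctx (S.extend G.N₀ G.N₁)} (h : Ctx.node f i ts K ∈ G.ctxStates) : K ∈ G.ctxStates := by
  obtain ⟨ρ, hρ, h⟩ := Set.mem_iUnion₂.1 h
  exact Set.mem_iUnion₂.2 ⟨ρ, hρ, Ctx.spine_mem_subcontexts h⟩

variable (G)

/-! Occurrences of derivations in derivations.  They are described by what matters for pumping: any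
other derivation from the same sentential form may be put in place of the one that occurs. -/

/-- A derivation of `t'` from `s'` occurs in a derivation of `t` from `s`. -/
def OccTT (s : Tree (S.extend G.N₀ G.N₁)) (t : Tree S) (s' : Tree (S.extend G.N₀ G.N₁))
    (t' : Tree S) : Prop :=
  ∃ E : Ctx S, t = E.fill t' ∧ ∀ u, G.Gen s' u → G.Gen s (E.fill u)

/-- A derivation of the context `C` from `R` occurs in a derivation of `t` from `s`. -/
def OccTC (s : Tree (S.extend G.N₀ G.N₁)) (t : Tree S) (R : Ctx (S.extend G.N₀ G.N₁))
    (C : Ctx S) : Prop :=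
  ∃ (E : Ctx S) (u : Tree S), t = E.fill (C.fill u) ∧
    ∀ D, G.GenCtx R D → G.Gen s (E.fill (D.fill u))

/-- A derivation of `t'` from `s'` occurs in a derivation of the context `C` from `R`, beside the
path to the hole. -/
def OccCT (R : Ctx (S.extend G.N₀ G.N₁)) (C : Ctx S) (s' : Tree (S.extend G.N₀ G.N₁))
    (t' : Tree S) : Prop :=
  ∃ E : Tree S → Ctx S, (∀ u, C.fill u = (E u).fill t') ∧
    ∀ v, G.Gen s' v → ∃ D, G.GenCtx R D ∧ ∀ u, D.fill u = (E u).fill v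

/-- A derivation of the context `C'` from `R'` occurs in a derivation of the context `C` from `R`,
on the path to the hole. -/
def OccCC (R : Ctx (S.extend G.N₀ G.N₁)) (C : Ctx S) (R' : Ctx (S.extend G.N₀ G.N₁))
    (C' : Ctx S) : Prop :=
  ∃ E F : Ctx S, C = E.comp (C'.comp F) ∧ ∀ D, G.GenCtx R' D → G.GenCtx R (E.comp (D.comp F))

variable {G} {s s' s'' : Tree (S.extend G.N₀ G.N₁)} {t t' t'' : Tree S}
  {R R' R'' : Ctx (S.extend G.N₀ G.N₁)} {C C' C'' : Ctx S}

theorem OccTT.refl : G.OccTT s t s t := ⟨.hole, rfl, fun _ h => h⟩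

theorem OccCC.refl : G.OccCC R C R C :=
  ⟨.hole, .hole, (Ctx.comp_hole C).symm, fun D h => by rwa [Ctx.comp_hole]⟩

theorem OccTT.trans (h : G.OccTT s t s' t') (h' : G.OccTT s' t' s'' t'') :
    G.OccTT s t s'' t'' := by
  obtain ⟨E, rfl, hE⟩ := h
  obtain ⟨F, rfl, hF⟩ := h'
  refine ⟨E.comp F, by rw [Ctx.fill_comp], fun u hu => ?_⟩
  rw [Ctx.fill_comp]
  exact hE _ (hF u hu)

theorem OccTC.trans (h : G.OccTC s t R C) (h' : G.OccCT R C s' t') : G.OccTT s t s' t' := by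
  obtain ⟨E, u, rfl, hE⟩ := h
  obtain ⟨F, hF, hF'⟩ := h'
  refine ⟨E.comp (F u), by rw [Ctx.fill_comp, hF], fun v hv => ?_⟩
  obtain ⟨D, hD, hDF⟩ := hF' v hv
  rw [Ctx.fill_comp, ← hDF]
  exact hE D hD

theorem OccCT.trans (h : G.OccCT R C s t) (h' : G.OccTT s t s' t') : G.OccCT R C s' t' := by
  obtain ⟨E, hE, hE'⟩ := h
  obtain ⟨F, rfl, hF⟩ := h'
  refine ⟨fun u => (E u).comp F, fun u => by rw [Ctx.fill_comp, hE], fun v hv => ?_⟩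
  obtain ⟨D, hD, hDE⟩ := hE' _ (hF v hv)
  exact ⟨D, hD, fun u => by rw [Ctx.fill_comp, hDE]⟩

theorem OccCC.trans_tree (h : G.OccCC R C R' C') (h' : G.OccCT R' C' s t) : G.OccCT R C s t := by
  obtain ⟨E, F, rfl, hE⟩ := h
  obtain ⟨E', h₁, h₂⟩ := h'
  refine ⟨fun u => E.comp (E' (F.fill u)), fun u => by simp only [Ctx.fill_comp, h₁],
    fun v hv => ?_⟩
  obtain ⟨D, hD, hDE⟩ := h₂ v hv
  exact ⟨_, hE D hD, fun u => by simp only [Ctx.fill_comp, hDE]⟩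

theorem OccCC.trans (h : G.OccCC R C R' C') (h' : G.OccCC R' C' R'' C'') :
    G.OccCC R C R'' C'' := by
  obtain ⟨E, F, rfl, hE⟩ := h
  obtain ⟨E', F', rfl, hE'⟩ := h'
  refine ⟨E.comp E', F'.comp F, by simp only [Ctx.comp_assoc], fun D hD => ?_⟩
  have := hE _ (hE' D hD)
  simpa only [Ctx.comp_assoc] using this

/-- The derivations that occur immediately below the root of a derivation of a tree. -/
theorem DerTree.height_le {n : ℕ} (h : G.DerTree (n + 1) s t) (hs : s ∈ G.treeStates) {b₀ b₁ : ℕ}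
    (h₀ : ∀ s' t', s' ∈ G.treeStates → G.DerTree n s' t' → G.OccTT s t s' t' → t'.height ≤ b₀)
    (h₁ : ∀ R C, R ∈ G.ctxStates → G.DerCtx n R C → G.OccTC s t R C → C.height ≤ b₁) :
    t.height ≤ 1 + b₀ + b₁ := by
  rcases h with (⟨_, f, ts, ts', h⟩ | ⟨_, A, ts, r, _, hr, h⟩ | ⟨_, A, ts, R, C, t, hR, h, h'⟩)
  · have : (Tree.node f ts').height ≤ 1 + b₀ := by
      refine Tree.height_node_le fun j => h₀ (ts j) (ts' j) (child_mem_treeStates hs j) (h j)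
        ⟨Ctx.around f ts' j, (Ctx.around_fill_self f ts' j).symm, fun u hu => ?_⟩
      rw [Ctx.around_fill]
      refine Gen.term fun l => ?_
      by_cases hl : l = j
      · subst hl
        rwa [Function.update_self]
      · rw [Function.update_of_ne hl]
        exact ⟨n, h l⟩
    omega
  · have := h₀ r t (mem_treeStates_of_rule hr) h ⟨.hole, rfl, fun u hu => Gen.nt₀ hr hu⟩
    omega
  · have h₂ := h₀ (ts 0) t (child_mem_treeStates hs (0 : Fin 1)) h'
      ⟨C, rfl, fun u hu => Gen.nt₁ hR ⟨n, h⟩ hu⟩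
    have h₃ := h₁ R C (mem_ctxStates_of_rule hR) h
      ⟨.hole, t, rfl, fun D hD => Gen.nt₁ (C := D) hR hD ⟨n, h'⟩⟩
    have := C.height_fill_le t
    omega

/-- The derivations that occur immediately below the root of a derivation of a context. -/
theorem DerCtx.height_le {n : ℕ} (h : G.DerCtx (n + 1) R C) (hR : R ∈ G.ctxStates) {b₀ b₁ : ℕ}
    (h₀ : ∀ s t, s ∈ G.treeStates → G.DerTree n s t → G.OccCT R C s t → t.height ≤ b₀)
    (h₁ : ∀ R' C', R' ∈ G.ctxStates → G.DerCtx n R' C' → G.OccCC R C R' C' → C'.height ≤ b₁) :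
    C.height ≤ 1 + b₀ + 2 * b₁ := by
  rcases h with (_ | ⟨_, f, i, ts, ts', K, C, h, h'⟩ | ⟨_, A, i, ts, R, K, C, C', hR', h, h'⟩)
  · simp [Ctx.height]
  · have : (Ctx.node f i ts' C).height ≤ 1 + (b₀ + b₁) := by
      refine Ctx.height_node_le (fun j => ?_) ?_
      · refine (h₀ (ts j) (ts' j) (side_mem_treeStates hR j) (h j)
          ⟨fun u => .node f j.1 (fun l => if hl : l.1 = i then C.fill u else ts' ⟨l.1, hl⟩) .hole,
            fun u => ?_, fun v hv => ⟨.node f i (Function.update ts' j v) C,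
              GenCtx.term (fun l => ?_) ⟨n, h'⟩, fun u => ?_⟩⟩).trans (Nat.le_add_right _ _)
        · simp only [Ctx.fill]
          congr 1
          funext l
          by_cases hl : l = j.1
          · subst hl
            rw [dif_neg j.2, dif_pos rfl]
          · rw [dif_neg hl]
        · by_cases hl : l = j
          · subst hl
            rwa [Function.update_self]
          · rw [Function.update_of_ne hl]
            exact ⟨n, h l⟩
        · simp only [Ctx.fill]
          congr 1
          funext l
          by_cases hl : l = j.1
          · subst hl
            rw [dif_neg j.2, dif_pos rfl, Function.update_self]
          · rw [dif_neg hl]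
            by_cases hi : l = i
            · rw [dif_pos hi, dif_pos hi]
            · rw [dif_neg hi, dif_neg hi, Function.update_of_ne]
              exact fun e => hl (congrArg Subtype.val e)
      · refine (h₁ K C (spine_mem_ctxStates hR) h' ⟨.node f i ts' .hole, .hole, ?_,
          fun D hD => ?_⟩).trans (Nat.le_add_left _ _)
        · simp only [Ctx.comp, Ctx.comp_hole]
        · simp only [Ctx.comp, Ctx.comp_hole]
          exact GenCtx.term (fun j => ⟨n, h j⟩) hD
    omega
  -- A nonterminal of rank one composes two derived contexts, whence the factor `2` in the bound.
  · have h₂ := h₁ R C (mem_ctxStates_of_rule hR') h ⟨.hole, C', rfl, fun D hD =>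
      GenCtx.nt₁ (C := D) hR' hD ⟨n, h'⟩⟩
    have h₃ := h₁ K C' (spine_mem_ctxStates hR) h' ⟨C, .hole, by rw [Ctx.comp_hole], fun D hD => by
      rw [Ctx.comp_hole]
      exact GenCtx.nt₁ hR' ⟨n, h⟩ hD⟩
    have := C.height_comp_le C'
    omega

-- Pumping of recurring states

variable (G)

/-- `t` has a pumping decomposition with respect to the trees derived from `s`. -/
def PumpTree (p : ℕ) (s : Tree (S.extend G.N₀ G.N₁)) (t : Tree S) : Prop :=
  ∃ C₁ C₂ C₃ C₄ t₅, IsPumpingDecomposition {u | G.Gen s u} p t C₁ C₂ C₃ C₄ t₅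

/-- `C` can be pumped with respect to the contexts derived from `R`, whatever tree is put into its
hole. -/
def PumpCtx (p : ℕ) (R : Ctx (S.extend G.N₀ G.N₁)) (C : Ctx S) : Prop :=
  ∃ C₂ C₃ C₄ : Ctx S, ∀ u, ∃ C₁ t₅, IsPumpingDecomposition
    {v | ∃ D, G.GenCtx R D ∧ v = D.fill u} p (C.fill u) C₁ C₂ C₃ C₄ t₅

variable {G} {p : ℕ}

theorem PumpTree.of_occTT (h : G.OccTT s t s' t') (h' : G.PumpTree p s' t') : G.PumpTree p s t := by
  obtain ⟨E, rfl, hE⟩ := h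
  obtain ⟨C₁, C₂, C₃, C₄, t₅, rfl, h₁, h₂, h₃⟩ := h'
  refine ⟨E.comp C₁, C₂, C₃, C₄, t₅, by rw [Ctx.fill_comp], h₁, h₂, fun i => ?_⟩
  rw [Ctx.fill_comp]
  exact hE _ (h₃ i)

theorem PumpTree.of_occTC (h : G.OccTC s t R C) (h' : G.PumpCtx p R C) : G.PumpTree p s t := by
  obtain ⟨E, u, rfl, hE⟩ := h
  obtain ⟨C₂, C₃, C₄, h'⟩ := h'
  obtain ⟨C₁, t₅, h₀, h₁, h₂, h₃⟩ := h' u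
  refine ⟨E.comp C₁, C₂, C₃, C₄, t₅, by rw [Ctx.fill_comp, h₀], h₁, h₂, fun i => ?_⟩
  obtain ⟨D, hD, e⟩ := h₃ i
  rw [Ctx.fill_comp, e]
  exact hE D hD

theorem PumpCtx.of_occCT (h : G.OccCT R C s t) (h' : G.PumpTree p s t) : G.PumpCtx p R C := by
  obtain ⟨E, hE, hE'⟩ := h
  obtain ⟨C₁, C₂, C₃, C₄, t₅, rfl, h₁, h₂, h₃⟩ := h'
  refine ⟨C₂, C₃, C₄, fun u => ⟨(E u).comp C₁, t₅, by rw [Ctx.fill_comp, hE], h₁, h₂,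
    fun i => ?_⟩⟩
  obtain ⟨D, hD, e⟩ := hE' _ (h₃ i)
  exact ⟨D, hD, by rw [Ctx.fill_comp, e]⟩

theorem PumpCtx.of_occCC (h : G.OccCC R C R' C') (h' : G.PumpCtx p R' C') : G.PumpCtx p R C := by
  obtain ⟨E, F, rfl, hE⟩ := h
  obtain ⟨C₂, C₃, C₄, h'⟩ := h'
  refine ⟨C₂, C₃, C₄, fun u => ?_⟩
  obtain ⟨C₁, t₅, h₀, h₁, h₂, h₃⟩ := h' (F.fill u)
  refine ⟨E.comp C₁, t₅, by simp only [Ctx.fill_comp, h₀], h₁, h₂, fun i => ?_⟩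
  obtain ⟨D, hD, e⟩ := h₃ i
  exact ⟨_, hE D hD, by simp only [Ctx.fill_comp, e]⟩

/-- The context `E` between the two occurrences is iterated, with `C₃` and `C₄` equal to the hole,
so the `i`-th tree is `Eⁱ[t']`. -/
theorem PumpTree.of_recurrence (h : G.OccTT s t s t') (hne : t ≠ t') (ht' : G.Gen s t')
    (hp : t.height ≤ p) : G.PumpTree p s t := by
  obtain ⟨E, rfl, hE⟩ := h
  have hE₀ : E ≠ .hole := by
    rintro rfl
    exact hne rfl
  refine ⟨.hole, E, .hole, .hole, t', rfl, ?_, Nat.add_pos_left (Ctx.height_pos hE₀) _,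
    fun i => ?_⟩
  · simp only [Ctx.comp, Ctx.comp_hole]
    exact (E.height_le_fill t').trans hp
  · induction i with
    | zero => exact ht'
    | succ i ih =>
      simp only [Ctx.fill, pump, Ctx.fill_comp] at ih ⊢
      exact hE _ ih

/-- A recurrence on the spine is two-sided: `E` and `F` are iterated above and below `C'`. -/
theorem PumpCtx.of_recurrence (h : G.OccCC R C R C') (hne : C ≠ C') (hC' : G.GenCtx R C')
    (hp : C.height ≤ p) : G.PumpCtx p R C := by
  obtain ⟨E, F, rfl, hE⟩ := h
  refine ⟨E, C', F, fun u => ⟨.hole, u, by simp only [Ctx.fill_comp, Ctx.fill], hp, ?_,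
    fun i => ⟨pump E C' F i, ?_, rfl⟩⟩⟩
  · by_contra! h
    have hE₀ : E = .hole := by
      by_contra hE₀
      have := Ctx.height_pos hE₀
      omega
    have hF₀ : F = .hole := by
      by_contra hF₀
      have := Ctx.height_pos hF₀
      omega
    subst hE₀ hF₀
    exact hne (Ctx.comp_hole C')
  · induction i with
    | zero => exact hC'
    | succ i ih => exact hE _ ih

/-! The pumping height -/

/-- A bound for the heights of contexts without recurrence, if trees beside the path to the hole
have height at most `b` and there are `k` states. -/
def ctxBound (b : ℕ) : ℕ → ℕ
  | 0 => 0
  | k + 1 => 1 + b + 2 * ctxBound b k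

/-- A bound for the heights of trees without recurrence, if there are `k` states for trees and `m`
states for contexts. -/
def treeBound (m : ℕ) : ℕ → ℕ
  | 0 => 0
  | k + 1 => 1 + treeBound m k + ctxBound (treeBound m k) m

-- Induction on the bound for the height of the derivation. `F₀` and `F₁` collect states that no
-- longer occur, so `k` and `l` bound the numbers of states still available. A state that cannot be
-- pumped does not recur below the root of a suitable derivation and joins its set. Passing from a
-- tree to a context uses up a tree state and resets `F₁`; passing to a context on the spine uses up
-- a context state and keeps `F₀`.
open Classical in
theorem pump_or_height_le (Q₀ : Finset (Tree (S.extend G.N₀ G.N₁)))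
    (Q₁ : Finset (Ctx (S.extend G.N₀ G.N₁))) (hQ₀ : ∀ s, s ∈ Q₀ ↔ s ∈ G.treeStates)
    (hQ₁ : ∀ R, R ∈ Q₁ ↔ R ∈ G.ctxStates)
    (hp : 1 + treeBound Q₁.card Q₀.card + 2 * ctxBound (treeBound Q₁.card Q₀.card) Q₁.card ≤ p)
    (n : ℕ) :
    (∀ s t, s ∈ G.treeStates → G.DerTree n s t → ∀ (F₀ : Finset _) (k : ℕ), (Q₀ \ F₀).card ≤ k →
      (∀ s' ∈ F₀, ∀ m ≤ n, ∀ t', G.DerTree m s' t' → ¬ G.OccTT s t s' t') →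
      G.PumpTree p s t ∨ t.height ≤ treeBound Q₁.card k) ∧
    (∀ R C, R ∈ G.ctxStates → G.DerCtx n R C → ∀ (F₀ : Finset _) (k : ℕ), (Q₀ \ F₀).card ≤ k →
      (∀ s' ∈ F₀, ∀ m ≤ n, ∀ t', G.DerTree m s' t' → ¬ G.OccCT R C s' t') →
      ∀ (F₁ : Finset _) (l : ℕ), (Q₁ \ F₁).card ≤ l →
      (∀ R' ∈ F₁, ∀ m ≤ n, ∀ C', G.DerCtx m R' C' → ¬ G.OccCC R C R' C') →
      G.PumpCtx p R C ∨ C.height ≤ ctxBound (treeBound Q₁.card k) l) := by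
  induction n using Nat.strong_induction_on with
  | _ n ih =>
  rcases n with _ | n
  · exact ⟨fun s t _ h => (nomatch h), fun R C _ h => (nomatch h)⟩
  have card_insert : ∀ {α : Type} (Q F : Finset α) (x : α) (k : ℕ), x ∈ Q → x ∉ F →
      (Q \ F).card ≤ k + 1 → (Q \ insert x F).card ≤ k := by
    intro α Q F x k hx hxF hk
    rw [Finset.sdiff_insert, Finset.card_erase_of_mem (Finset.mem_sdiff.2 ⟨hx, hxF⟩)]
    omega
  constructor
  · intro s t hs hd F₀ k hk hF₀
    by_contra! hcon
    obtain ⟨hpump, hheight⟩ := hcon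
    -- The derivations just below the root cannot be pumped either, so the crude bounds with no
    -- excluded states apply to them. This makes the height small enough for pumping a recurrence at
    -- the root.
    have hp₀ : t.height ≤ p := by
      refine (hd.height_le hs (b₀ := treeBound Q₁.card Q₀.card)
        (b₁ := ctxBound (treeBound Q₁.card Q₀.card) Q₁.card) ?_ ?_).trans (by omega)
      · intro s' t' hs' hd' hocc
        refine ((ih n n.lt_succ_self).1 s' t' hs' hd' ∅ _ (by simp) (by simp)).resolve_left
          fun h => hpump (.of_occTT hocc h)
      · intro R C hR hd' hocc
        refine ((ih n n.lt_succ_self).2 R C hR hd' ∅ _ (by simp) (by simp) ∅ _ (by simp)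
          (by simp)).resolve_left fun h => hpump (.of_occTC hocc h)
    -- A recurrence with a different tree can be pumped. A recurrence with the same tree generates
    -- nothing, but it provides a shorter derivation of `t`, to which the induction hypothesis
    -- applies.
    have hrec : ∀ m ≤ n, ∀ t', G.DerTree m s t' → ¬ G.OccTT s t s t' := by
      intro m hm t' hd' hocc
      by_cases ht : t = t'
      · subst ht
        rcases (ih m (by omega)).1 s t hs hd' F₀ k hk
          (fun s' hs' m' hm' => hF₀ s' hs' m' (by omega)) with h | h
        · exact hpump h
        · omega
      · exact hpump (.of_recurrence hocc ht ⟨m, hd'⟩ hp₀)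
    have hsF : s ∉ F₀ := fun h => hF₀ s h _ le_rfl t hd .refl
    rcases k with _ | k
    -- No state is left, although `s` itself occurs.
    · have : s ∈ Q₀ \ F₀ := Finset.mem_sdiff.2 ⟨(hQ₀ s).2 hs, hsF⟩
      rw [Finset.card_eq_zero.1 (Nat.le_zero.1 hk)] at this
      simp at this
    have hk' := card_insert Q₀ F₀ s k ((hQ₀ s).2 hs) hsF hk
    have hF₀' : ∀ s' ∈ insert s F₀, ∀ m ≤ n, ∀ t', G.DerTree m s' t' → ¬ G.OccTT s t s' t' := by
      intro s' hs' m hm t'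
      rcases Finset.mem_insert.1 hs' with rfl | hs'
      · exact hrec m hm t'
      · exact hF₀ s' hs' m (by omega) t'
    refine hheight.not_ge (hd.height_le hs (fun s' t' hs' hd' hocc => ?_)
      fun R C hR hd' hocc => ?_)
    · exact ((ih n n.lt_succ_self).1 s' t' hs' hd' _ k hk' fun s'' hs'' m hm t'' hd'' hocc' =>
        hF₀' s'' hs'' m hm t'' hd'' (hocc.trans hocc')).resolve_left
          fun h => hpump (.of_occTT hocc h)
    · exact ((ih n n.lt_succ_self).2 R C hR hd' _ k hk' (fun s'' hs'' m hm t'' hd'' hocc' =>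
        hF₀' s'' hs'' m hm t'' hd'' (hocc.trans hocc')) ∅ _ (by simp) (by simp)).resolve_left
          fun h => hpump (.of_occTC hocc h)
  · intro R C hR hd F₀ k hk hF₀ F₁ l hl hF₁
    by_contra! hcon
    obtain ⟨hpump, hheight⟩ := hcon
    have hp₀ : C.height ≤ p := by
      refine (hd.height_le hR (b₀ := treeBound Q₁.card Q₀.card)
        (b₁ := ctxBound (treeBound Q₁.card Q₀.card) Q₁.card) ?_ ?_).trans (by omega)
      · intro s' t' hs' hd' hocc
        refine ((ih n n.lt_succ_self).1 s' t' hs' hd' ∅ _ (by simp) (by simp)).resolve_left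
          fun h => hpump (.of_occCT hocc h)
      · intro R C hR hd' hocc
        refine ((ih n n.lt_succ_self).2 R C hR hd' ∅ _ (by simp) (by simp) ∅ _ (by simp)
          (by simp)).resolve_left fun h => hpump (.of_occCC hocc h)
    have hrec : ∀ m ≤ n, ∀ C', G.DerCtx m R C' → ¬ G.OccCC R C R C' := by
      intro m hm C' hd' hocc
      by_cases ht : C = C'
      · subst ht
        rcases (ih m (by omega)).2 R C hR hd' F₀ k hk
          (fun s' hs' m' hm' => hF₀ s' hs' m' (by omega)) F₁ l hl
          (fun R' hR' m' hm' => hF₁ R' hR' m' (by omega)) with h | h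
        · exact hpump h
        · omega
      · exact hpump (.of_recurrence hocc ht ⟨m, hd'⟩ hp₀)
    have hRF : R ∉ F₁ := fun h => hF₁ R h _ le_rfl C hd .refl
    rcases l with _ | l
    · have : R ∈ Q₁ \ F₁ := Finset.mem_sdiff.2 ⟨(hQ₁ R).2 hR, hRF⟩
      rw [Finset.card_eq_zero.1 (Nat.le_zero.1 hl)] at this
      simp at this
    have hl' := card_insert Q₁ F₁ R l ((hQ₁ R).2 hR) hRF hl
    refine hheight.not_ge (hd.height_le hR (fun s' t' hs' hd' hocc => ?_)
      fun R' C' hR' hd' hocc => ?_)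
    -- A side tree inherits `F₀` and `k` unchanged; this is the `b` in `ctxBound b`.
    · exact ((ih n n.lt_succ_self).1 s' t' hs' hd' F₀ k hk fun s'' hs'' m hm t'' hd'' hocc' =>
        hF₀ s'' hs'' m (by omega) t'' hd'' (hocc.trans hocc')).resolve_left
          fun h => hpump (.of_occCT hocc h)
    · refine ((ih n n.lt_succ_self).2 R' C' hR' hd' F₀ k hk (fun s'' hs'' m hm t'' hd'' hocc' =>
        hF₀ s'' hs'' m (by omega) t'' hd'' (hocc.trans_tree hocc')) (insert R F₁) l hl' ?_
        ).resolve_left fun h => hpump (.of_occCC hocc h)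
      intro R'' hR'' m hm C'' hd'' hocc'
      rcases Finset.mem_insert.1 hR'' with rfl | hR''
      · exact hrec m hm C'' hd'' (hocc.trans hocc')
      · exact hF₁ R'' hR'' m (by omega) C'' hd'' (hocc.trans hocc')

/-- The languages of linear monadic context-free tree grammars have pumping heights. -/
theorem exists_isPumpingHeight (G : LMCFTG S) : ∃ p, IsPumpingHeight G.language p := by
  classical
  let Q₀ := G.finite_treeStates.toFinset
  let Q₁ := G.finite_ctxStates.toFinset
  refine ⟨1 + treeBound Q₁.card Q₀.card + 2 * ctxBound (treeBound Q₁.card Q₀.card) Q₁.card,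
    fun t ht hheight => ?_⟩
  have hlang : G.language = {t | G.Gen (Tree.nt₀ S G.N₁ G.start) t} :=
    Set.ext fun _ => mem_language_iff_gen
  rw [hlang] at ht ⊢
  obtain ⟨n, hn⟩ := ht
  rcases (pump_or_height_le Q₀ Q₁ (by simp [Q₀]) (by simp [Q₁]) le_rfl n).1 _ t
    (Set.mem_insert _ _) hn ∅ Q₀.card (by simp) (by simp) with h | h
  · exact h
  · omega

end LMCFTG

end CrossSerial

theorem lemma9 (S : Signature) (hS : Finite S.Sym) (lex : S.Sym → Option Token)
    (G : LMCFTG S) (k : ℕ) (L : Type) (h : HRHom S k L)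
    (hCSD : Prod.fst '' REL G lex h = CSDStrings) :
    (∃ p : ℕ, IsPumpingHeight G.language p) ∧
    ∀ p : ℕ, IsPumpingHeight G.language p →
      ∃ l₀ : ℕ, IsGreatest (generatedSizes lex h p) l₀ ∧
        ∀ t ∈ G.language, ∃ xy ∈ SepPairs, IsSeparated lex xy.1 xy.2 l₀ t := by
  refine ⟨LMCFTG.exists_isPumpingHeight G, fun p hp => ?_⟩
  obtain ⟨l, hl⟩ := exists_isGreatest_generatedSizes hS lex h p
  have hT : ∀ t ∈ G.language, t.yield lex ∈ CSDStrings := fun t ht => by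
    rw [← hCSD]
    -- Each tree of the language contributes its own graph, by the identity isomorphism.
    exact ⟨(t.yield lex, (h.tree t).eval), ⟨t, ht, rfl, Equiv.refl _, by simp, by simp⟩, rfl⟩
  refine ⟨l, hl, fun t ht => ?_⟩
  by_contra! hsep
  exact hp.not_hasSpread hT (fun C hC => hl.2 ⟨C, hC, Or.inl rfl⟩) t ht
    (hasSpread_of_not_isSeparated lex (hT t ht) (hsep (.a, .c) (by simp [SepPairs]))
      (hsep (.d, .b) (by simp [SepPairs])))
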